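/- Let $x=P(x)$ be a monotone polynomial system (MPS) in $n\ge 1$ variables: $P=(P_1,\dots,P_n)$, where each $P_i$ is a polynomial of total degree at most $2$ in $x=(x_1,\dots,x_n)$ with non-negative real coefficients. Assume that it has a least fixed point (LFP) $q^*\in\mathbb{R}^n_{\ge 0}$ (a non-negative solution that is coordinatewise at most every non-negative solution) and that $0<q^*_i\le 1$ for all $i$. Definitions. Let $c_{\min}$ be the smallest non-zero coefficient or constant in $P$, $q^*_{\min}=\min_i q^*_i$, $\alpha=\min\{1,c_{\min}\}\cdot\frac12 q^*_{\min}$, and $\mathbf 1=(1,\dots,1)$. The dependency graph has an edge from $x_i$ to $x_j$ iff $x_j$ occurs in $P_i$; $H_P$ is the DAG of its strongly connected components (SCCs). For an SCC $S$, let $D(S)$ be the set of variables outside $S$ reachable from $S$, and write the equations of $S$ as $x_S=P_S(x_S,x_{D(S)})$; $S$ is linear if $P_S(x_S,q^*_{D(S)})$ has degree at most $1$ in $x_S$, and nonlinear otherwise. Let $d$ be the maximum number of SCCs on a directed path of $H_P$, and $f$ the maximum number of nonlinear SCCs on a directed path of $H_P$. Rounded-down Newton's method with rounding parameter $h$ on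 a system $x=Q(x)$ with Jacobian $B(x)=Q'(x)$ starts from $x^{[0]}=0$; given $x^{[k]}$, with $I-B(x^{[k]})$ non-singular, $x^{[k+1]}_i$ is the largest multiple of $2^{-h}$ that is at most $\max\big(\big(x^{[k]}+(I-B(x^{[k]}))^{-1}(Q(x^{[k]})-x^{[k]})\big)_i,\,0\big)$. Rounded-down decomposed Newton's method (R-DNM) processes the SCCs of $H_P$ bottom-up: when $\tilde q_{D(S)}$ has been computed, $\tilde q_S$ is the result of rounded-down Newton's method with parameter $h$ on $x_S=P_S(x_S,\tilde q_{D(S)})$, with $1$ iteration if $S$ is linear and $g$ iterations if $S$ is nonlinear. Theorem. Let $0<\epsilon<1$, and let the integers $h$ and $g$ satisfy $$h\ \ge\ \Big\lceil 3+2^f\cdot\Big(\log_2\tfrac1\epsilon+d\cdot\big(\log_2(\alpha^{-(4n+1)})+\log_2(16n)+\log_2\|P(\mathbf 1)\|_\infty\big)\Big)\Big\rceil,\qquad g\ \ge\ h-1.$$ Then all iterations of R-DNM with rounding parameter $h$ and $g$ iterations for every nonlinear SCC (and $1$ for every linear SCC) are defined, and its (unique) result $\tilde q$ satisfies $\tilde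 q\le q^*$ and $\|q^*-\tilde q\|_\infty\le\epsilon$. -/

import Mathlib

open MvPolynomial

/-- `x = P(x)` is a monotone polynomial system: every coefficient is non-negative. -/
def IsMPS {σ : Type*} (P : σ → MvPolynomial σ ℝ) : Prop :=
  ∀ i m, 0 ≤ (P i).coeff m

/-- Every polynomial of the system has (total) degree at most `2`. -/
def IsQuadratic {σ : Type*} (P : σ → MvPolynomial σ ℝ) : Prop :=
  ∀ i, (P i).totalDegree ≤ 2

/-- `q` is the least non-negative (real) solution of `x = P(x)`. -/
def IsLFP {σ : Type*} (P : σ → MvPolynomial σ ℝ) (q : σ → ℝ) : Prop :=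
  IsLeast {a : σ → ℝ | 0 ≤ a ∧ ∀ i, eval a (P i) = a i} q

/-- The least non-zero coefficient or constant of the system (a minimum over a finite set). -/
noncomputable def coeffMin {σ : Type*} (P : σ → MvPolynomial σ ℝ) : ℝ :=
  sInf {c : ℝ | c ≠ 0 ∧ ∃ i m, (P i).coeff m = c}

/-! ### Newton's method with rounding down -/

/-- The Jacobian matrix `B(z)` of `P` at `z`. -/
noncomputable def jacobian {σ : Type*} (P : σ → MvPolynomial σ ℝ) (z : σ → ℝ) :
    Matrix σ σ ℝ :=
  Matrix.of fun i j => eval z (pderiv j (P i))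

/-- The Newton operator `N_P(z) = z + (I - B(z))⁻¹ (P(z) - z)`; it is only meaningful when
`I - B(z)` is non-singular, which `RNMDefined` records. -/
noncomputable def newton {σ : Type*} [Fintype σ] [DecidableEq σ]
    (P : σ → MvPolynomial σ ℝ) (z : σ → ℝ) : σ → ℝ :=
  z + (1 - jacobian P z)⁻¹.mulVec (fun i => eval z (P i) - z i)

/-- The largest multiple of `2^(-h)` which is at most `max t 0`. -/
noncomputable def roundDown (h : ℕ) (t : ℝ) : ℝ :=
  (⌊max t 0 * 2 ^ h⌋ : ℝ) / 2 ^ h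

/-- The iterates `x^[k]` of the rounded-down Newton method with rounding parameter `h`. -/
noncomputable def rnm {σ : Type*} [Fintype σ] [DecidableEq σ]
    (P : σ → MvPolynomial σ ℝ) (h : ℕ) : ℕ → σ → ℝ
  | 0 => 0
  | k + 1 => fun i => roundDown h (newton P (rnm P h k) i)

/-- The first `k` iterations of the rounded-down Newton method are all defined. -/
def RNMDefined {σ : Type*} [Fintype σ] [DecidableEq σ]
    (P : σ → MvPolynomial σ ℝ) (h k : ℕ) : Prop :=
  ∀ l < k, IsUnit (1 - jacobian P (rnm P h l))

/-! ### Dependency graph and its strongly connected components -/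

/-- The edges of the dependency graph: `x_j` appears in `P_i`. -/
def DepEdge {σ : Type*} (P : σ → MvPolynomial σ ℝ) (i j : σ) : Prop :=
  j ∈ (P i).vars

/-- There is a (possibly trivial) directed path from `i` to `j` in the dependency graph. -/
def Reaches {σ : Type*} (P : σ → MvPolynomial σ ℝ) (i j : σ) : Prop :=
  Relation.ReflTransGen (DepEdge P) i j

/-- `S` is (the set of variables of) a strongly connected component. -/
def IsSCC {σ : Type*} (P : σ → MvPolynomial σ ℝ) (S : Set σ) : Prop :=
  ∃ i, S = {j | Reaches P i j ∧ Reaches P j i}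

/-- The edges of the DAG of SCCs. -/
def DagEdge {σ : Type*} (P : σ → MvPolynomial σ ℝ) (S T : Set σ) : Prop :=
  S ≠ T ∧ ∃ i ∈ S, ∃ j ∈ T, DepEdge P i j

/-- `l` lists the SCCs along a directed path of the DAG of SCCs. -/
def IsDagPath {σ : Type*} (P : σ → MvPolynomial σ ℝ) (l : List (Set σ)) : Prop :=
  (∀ S ∈ l, IsSCC P S) ∧ l.IsChain (DagEdge P)

open Classical in
/-- The system `x_S = P_S(x_S, y)`, in the variables of `S` only: all variables outside `S` are
replaced by their values under `y`. If `S` is an SCC, then only the values of `y` on the set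
`D(S)` of the variables of the SCCs below `S` matter, as `P_S` has no other variables. -/
noncomputable def subsystem {σ : Type*} (P : σ → MvPolynomial σ ℝ) (S : Set σ) (y : σ → ℝ) :
    S → MvPolynomial S ℝ :=
  fun i => aeval (fun j => if hj : j ∈ S then X ⟨j, hj⟩ else C (y j)) (P i)

/-- For the LFP `q`, the SCC `S` is linear: `x_S = P_S(x_S, q)` is a linear system in `x_S`. -/
def IsLinearSCC {σ : Type*} (P : σ → MvPolynomial σ ℝ) (q : σ → ℝ) (S : Set σ) : Prop :=
  ∀ i : S, (subsystem P S q i).totalDegree ≤ 1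

/-- The depth: the maximum number of SCCs on a path of the DAG of SCCs. -/
noncomputable def sccDepth {σ : Type*} (P : σ → MvPolynomial σ ℝ) : ℕ :=
  sSup {k | ∃ l, IsDagPath P l ∧ k = l.length}

/-- The nonlinear depth: the maximum number of nonlinear SCCs on a path of the DAG of SCCs. -/
noncomputable def nonlinearDepth {σ : Type*} (P : σ → MvPolynomial σ ℝ) (q : σ → ℝ) : ℕ :=
  sSup {k | ∃ l, IsDagPath P l ∧ k = {S | S ∈ l ∧ ¬ IsLinearSCC P q S}.ncard}

/-! ### Rounded-down decomposed Newton's method -/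

open Classical in
/-- The number of Newton iterations on an SCC: `1` on a linear one, `g` on a nonlinear one. -/
noncomputable def sccIterations {σ : Type*} (P : σ → MvPolynomial σ ℝ) (q : σ → ℝ) (g : ℕ)
    (S : Set σ) : ℕ :=
  if IsLinearSCC P q S then 1 else g

open Classical in
/-- `r` is a result of the rounded-down decomposed Newton method on the cleaned MPS `x = P(x)` with
LFP `q`, with rounding parameter `h` and `g` iterations for nonlinear SCCs: for every SCC `S`, all
required rounded-down Newton iterations on `x_S = P_S(x_S, r_{D(S)})` are defined, and the last of
them is `r_S`. As `r_S` is computed from the values of `r` on lower SCCs only, this is a recursion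
along the DAG of SCCs, from the bottom up. -/
def RDNMReturns {σ : Type*} [Fintype σ] (P : σ → MvPolynomial σ ℝ) (q : σ → ℝ) (h g : ℕ)
    (r : σ → ℝ) : Prop :=
  ∀ S : Set σ, IsSCC P S →
    RNMDefined (subsystem P S r) h (sccIterations P q g S) ∧
    ∀ i : S, r i = rnm (subsystem P S r) h (sccIterations P q g S) i

/-- `α = min {1, c_min} · (1/2) · q_min`. -/
noncomputable def alphaConst {σ : Type*} (P : σ → MvPolynomial σ ℝ) (q : σ → ℝ) : ℝ :=
  min 1 (coeffMin P) * (1 / 2 * ⨅ i, q i)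

/-!
For a strongly connected component `S` with variables `x_S`, the system with the exact values `q`
inserted below is compared with the system with computed values `y ≤ q` inserted below. Both are
systems `x = b + L x + s(x, x)` with non-negative coefficients (`QuadSystem`), with the same
quadratic part `s` and with smaller `b` and `L` for `y`.

Along the dependency edges inside `S` the Jacobian `A` at `q` has entries at least `α`. As `S` is
strongly connected, all coordinates of a non-negative vector `v` with `A v ≤ v` are thus comparable
up to the factor `α ^ |S|` (`pow_card_mul_le_of_mulVec_le`). Since `q` is the least fixed point, `A`
has such a vector `d` (`QuadSystem.exists_jac_mulVec_le`), and then also a left one `w`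
(`exists_vecMul_le`). They control the three contributions to the error:

* Newton's method. The iterates stay below `q`, and strictly below it in the nonlinear case, so that
  the Jacobian there satisfies a strict maximum principle; all steps are therefore defined and
  `(I - B)⁻¹ ≥ 0`. If `p` is a fixed point of the system for `y` and `p - x ≤ λ d`, then
  `p - N(x) ≤ (λ / 2) d`, because the error of the linearisation is half of the change of the
  Jacobian; rounding adds at most `2 ^ (-h)` (`QuadSystem.nonlinear_newton_error`).
* The change of a nonlinear system. The difference `e = q - p` satisfies
  `e ≤ u + A e - s(e, e)`, where the residual `u` is `O(δ)` for values `y` with error `δ`. Testing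
  with `w` leaves `w s(e, e) ≤ w u`, and so `e = O(√δ)` (`QuadSystem.sq_sub_fixedPoint_le`).
* The change of a linear system. Here `e ≤ (I - A)⁻¹ u`, and the inverse is bounded because
  `(I - A)⁻¹ b = q ≤ 1` (`QuadSystem.linear_newton_error`).

Hence a component multiplies the error by at most
`Λ = 16 n ‖P(1)‖ α ^ (-(4 n + 1))`, and a nonlinear one takes a square root in addition. Following,
from each component, the neighbour with the largest error gives a path in the DAG of components
whose length and number of nonlinear components bound the error (`rdnm_error`). With
`θ = ε / Λ ^ d` and rounding errors at most `θ ^ (2 ^ f) / 8`, the result is `Λ ^ d θ = ε`.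
-/

/-! ### Non-negative matrices on a strongly connected graph -/

/-- A non-empty set of vertices of a strongly connected graph that is closed under outgoing edges
contains every vertex. -/
theorem mem_of_closed_of_strongConn {τ : Type*} {E : τ → τ → Prop}
    (hE : ∀ i j, Relation.ReflTransGen E i j) {Z : τ → Prop} {i₀ : τ} (h₀ : Z i₀)
    (hZ : ∀ i j, Z i → E i j → Z j) (i : τ) : Z i := by
  induction hE i₀ i with
  | refl => exact h₀
  | tail _ hij ih => exact hZ _ _ ih hij

/-- Harnack inequality: a supersolution `A v ≤ v` varies at most by the factor `a ^ |τ|`, if `a` is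
a lower bound for the entries of `A` along the edges of a strongly connected graph. -/
theorem pow_card_mul_le_of_mulVec_le {τ : Type*} [Fintype τ] {E : τ → τ → Prop}
    (hE : ∀ i j, Relation.ReflTransGen E i j) {A : Matrix τ τ ℝ} {a : ℝ} (ha0 : 0 ≤ a)
    (ha1 : a ≤ 1) (hA0 : ∀ i j, 0 ≤ A i j) (hA : ∀ i j, E i j → a ≤ A i j) {v : τ → ℝ}
    (hv : ∀ i, 0 ≤ v i) (hAv : ∀ i, A.mulVec v i ≤ v i) (i j : τ) :
    a ^ Fintype.card τ * v j ≤ v i := by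
  classical
  have edge : ∀ i k, E i k → a * v k ≤ v i := fun i k hik => by
    refine le_trans ?_ (hAv i)
    calc a * v k ≤ A i k * v k := by gcongr; exacts [hv k, hA i k hik]
      _ ≤ _ := Finset.single_le_sum (f := fun k => A i k * v k)
        (fun k _ => mul_nonneg (hA0 i k) (hv k)) (Finset.mem_univ k)
  let U : ℕ → Finset τ := fun m => Finset.univ.filter fun k => a ^ m * v j ≤ v k
  have hsub : ∀ m, U m ⊆ U (m + 1) := fun m k hk => by
    simp only [U, Finset.mem_filter, Finset.mem_univ, true_and] at hk ⊢
    refine le_trans ?_ hk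
    have := mul_nonneg (pow_nonneg ha0 m) (hv j)
    rw [pow_succ]; nlinarith
  have hj : ∀ m, j ∈ U m := fun m => by
    simp only [U, Finset.mem_filter, Finset.mem_univ, true_and]
    have := pow_le_one₀ (n := m) ha0 ha1
    nlinarith [hv j]
  -- the sets `U m` grow strictly until they contain every vertex
  have hcard : ∀ m, U m = Finset.univ ∨ m + 1 ≤ (U m).card := fun m => by
    induction m with
    | zero => exact Or.inr (Finset.card_pos.2 ⟨j, hj 0⟩)
    | succ m ih =>
      rcases ih with ih | ih
      · exact Or.inl (Finset.univ_subset_iff.1 (ih ▸ hsub m))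
      · by_cases hall : U m = Finset.univ
        · exact Or.inl (Finset.univ_subset_iff.1 (hall ▸ hsub m))
        · right
          obtain ⟨k, l, hk, hl, hkl⟩ : ∃ k l, k ∉ U m ∧ l ∈ U m ∧ E k l := by
            by_contra! hcon
            refine hall (Finset.eq_univ_iff_forall.2 fun k => ?_)
            by_contra hk
            exact mem_of_closed_of_strongConn hE (Z := fun k => k ∉ U m) hk
              (fun k l hk hkl hl => hcon k l hk hl hkl) j (hj m)
          refine Nat.succ_le_of_lt (lt_of_le_of_lt ih (Finset.card_lt_card ⟨hsub m, fun hs => ?_⟩))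
          refine hk (hs ?_)
          simp only [U, Finset.mem_filter, Finset.mem_univ, true_and] at hl ⊢
          refine le_trans ?_ (edge k l hkl)
          rw [pow_succ, mul_right_comm, mul_comm]; gcongr
  have : i ∈ U (Fintype.card τ) := by
    rcases hcard (Fintype.card τ) with h | h
    · rw [h]; exact Finset.mem_univ i
    · have := Finset.card_le_univ (U (Fintype.card τ)); omega
  simpa [U] using this

/-- Strict maximum principle: if `0 ≤ B ≤ A` with `A` irreducible, `A d ≤ d` and `B d ≠ d` for some
`d > 0`, then every `u` with `B u ≤ u` is non-negative. -/
theorem nonneg_of_mulVec_le {τ : Type*} [Fintype τ] {E : τ → τ → Prop}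
    (hE : ∀ i j, Relation.ReflTransGen E i j) {A B : Matrix τ τ ℝ}
    (hB0 : ∀ i j, 0 ≤ B i j) (hBA : ∀ i j, B i j ≤ A i j) (hA : ∀ i j, E i j → 0 < A i j)
    {d : τ → ℝ} (hd : ∀ i, 0 < d i) (hAd : ∀ i, A.mulVec d i ≤ d i) (hBd : B.mulVec d ≠ d)
    {u : τ → ℝ} (hu : ∀ i, B.mulVec u i ≤ u i) (i : τ) : 0 ≤ u i := by
  classical
  by_contra! hneg
  -- `t` is the largest value of `-u / d`, and it is attained on all of `τ`
  obtain ⟨m, -, hm⟩ := Finset.exists_max_image Finset.univ (fun i => -u i / d i) ⟨i, Finset.mem_univ i⟩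
  set t := -u m / d m with ht
  have htpos : 0 < t := lt_of_lt_of_le (div_pos (neg_pos.2 hneg) (hd i)) (hm i (Finset.mem_univ i))
  have hle : ∀ j, -u j ≤ t * d j := fun j => (div_le_iff₀ (hd j)).1 (hm j (Finset.mem_univ j))
  have key : ∀ k, -u k = t * d k →
      ∀ j, B k j * (t * d j + u j) = 0 ∧ (A k j - B k j) * d j = 0 := by
    intro k hk
    have h1 : ∑ j, B k j * (t * d j + u j) + t * ∑ j, (A k j - B k j) * d j ≤ 0 := by
      have e1 : ∑ j, B k j * (t * d j + u j) = t * B.mulVec d k + B.mulVec u k := by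
        simp only [Matrix.mulVec, dotProduct, Finset.mul_sum, ← Finset.sum_add_distrib]
        exact Finset.sum_congr rfl fun j _ => by ring
      have e2 : ∑ j, (A k j - B k j) * d j = A.mulVec d k - B.mulVec d k := by
        simp only [Matrix.mulVec, dotProduct, ← Finset.sum_sub_distrib]
        exact Finset.sum_congr rfl fun j _ => by ring
      rw [e1, e2]
      nlinarith [hAd k, hu k]
    have n1 : ∀ j ∈ Finset.univ, 0 ≤ B k j * (t * d j + u j) := fun j _ =>
      mul_nonneg (hB0 k j) (by linarith [hle j])
    have n2 : ∀ j ∈ Finset.univ, 0 ≤ (A k j - B k j) * d j := fun j _ =>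
      mul_nonneg (by linarith [hBA k j]) (hd j).le
    have s1 := Finset.sum_nonneg n1
    have s2 := Finset.sum_nonneg n2
    have z2 : ∑ j, (A k j - B k j) * d j = 0 := by nlinarith
    have z1 : ∑ j, B k j * (t * d j + u j) = 0 := by rw [z2] at h1; linarith
    exact fun j => ⟨(Finset.sum_eq_zero_iff_of_nonneg n1).1 z1 j (Finset.mem_univ j),
      (Finset.sum_eq_zero_iff_of_nonneg n2).1 z2 j (Finset.mem_univ j)⟩
  have hall : ∀ k, -u k = t * d k := by
    refine mem_of_closed_of_strongConn hE (i₀ := m)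
      (by rw [ht, div_mul_cancel₀ _ (hd m).ne']) fun k j hk hkj => ?_
    obtain ⟨h1, h2⟩ := key k hk j
    have hBpos : B k j = A k j := by
      rcases mul_eq_zero.1 h2 with h | h
      · linarith
      · exact absurd h (hd j).ne'
    rcases mul_eq_zero.1 h1 with h | h
    · exact absurd (hBpos ▸ h) (hA k j hkj).ne'
    · linarith
  refine hBd (funext fun k => le_antisymm ?_ ?_)
  · refine le_trans (Finset.sum_le_sum fun j _ => ?_) (hAd k)
    exact mul_le_mul_of_nonneg_right (hBA k j) (hd j).le
  · have e : B.mulVec u k = -t * B.mulVec d k := by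
      simp only [Matrix.mulVec, dotProduct, Finset.mul_sum]
      exact Finset.sum_congr rfl fun j _ => by
        have := hall j
        rw [show u j = -(t * d j) by linarith]; ring
    have := hu k
    rw [e, show u k = -(t * d k) by linarith [hall k]] at this
    nlinarith

/-- A matrix `1 - B` for which `B u ≤ u` implies `0 ≤ u` is non-singular. -/
theorem isUnit_one_sub_of_monotone {τ : Type*} [Fintype τ] [DecidableEq τ] {B : Matrix τ τ ℝ}
    (hmono : ∀ u : τ → ℝ, (∀ i, B.mulVec u i ≤ u i) → ∀ i, 0 ≤ u i) : IsUnit (1 - B) := by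
  rw [← Matrix.mulVec_injective_iff_isUnit]
  refine (injective_iff_map_eq_zero (Matrix.mulVecLin (1 - B))).2 fun u hu => funext fun i => ?_
  have hu' : B.mulVec u = u := by
    rw [Matrix.mulVecLin_apply, Matrix.sub_mulVec, Matrix.one_mulVec, sub_eq_zero] at hu
    exact hu.symm
  have h1 := hmono u (fun i => (congrFun hu' i).le) i
  have h2 := hmono (-u) (fun i => by rw [Matrix.mulVec_neg, hu']) i
  exact le_antisymm (by simpa using h2) h1

/-- If `B u ≤ u` implies `0 ≤ u`, then row `i` of the inverse of `1 - B` is a non-negative vector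
`w` with `w = w B + e_i`. -/
theorem exists_vecMul_add_single {τ : Type*} [Fintype τ] [DecidableEq τ] {B : Matrix τ τ ℝ}
    (hmono : ∀ u : τ → ℝ, (∀ i, B.mulVec u i ≤ u i) → ∀ i, 0 ≤ u i) (i : τ) :
    ∃ w : τ → ℝ, (∀ j, 0 ≤ w j) ∧ w = Matrix.vecMul w B + Pi.single i 1 := by
  have hU := isUnit_one_sub_of_monotone hmono
  have hdet := (Matrix.isUnit_iff_isUnit_det _).1 hU
  refine ⟨fun j => (1 - B)⁻¹ i j, fun j => ?_, ?_⟩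
  · refine hmono (fun k => (1 - B)⁻¹ k j) (fun k => ?_) i
    have h := congrFun (congrFun (Matrix.mul_nonsing_inv _ hdet) k) j
    rw [Matrix.sub_mul, Matrix.one_mul, Matrix.sub_apply] at h
    have h1 : (0 : ℝ) ≤ (1 : Matrix τ τ ℝ) k j := by
      rw [Matrix.one_apply]; split_ifs <;> norm_num
    have h2 : (B * (1 - B)⁻¹) k j = B.mulVec (fun k => (1 - B)⁻¹ k j) k := rfl
    linarith
  · funext j
    have h := congrFun (congrFun (Matrix.nonsing_inv_mul _ hdet) i) j
    rw [Matrix.mul_sub, Matrix.mul_one, Matrix.sub_apply] at h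
    have h2 : ((1 - B)⁻¹ * B) i j = Matrix.vecMul (fun j => (1 - B)⁻¹ i j) B j := rfl
    rw [Pi.add_apply, ← h2, Pi.single_apply]
    rw [Matrix.one_apply] at h
    simp only [eq_comm (a := j)] at *
    linarith

/-- An irreducible non-negative matrix with `A d ≤ d` for some `d > 0` also has a non-negative left
subinvariant vector: a row of `(1 - A)⁻¹` if `A d ≠ d`, and the absolute value of a left
eigenvector otherwise. -/
theorem exists_vecMul_le {τ : Type*} [Fintype τ] [Nonempty τ] {E : τ → τ → Prop}
    (hE : ∀ i j, Relation.ReflTransGen E i j) {A : Matrix τ τ ℝ} (hA0 : ∀ i j, 0 ≤ A i j)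
    (hA : ∀ i j, E i j → 0 < A i j) {d : τ → ℝ} (hd : ∀ i, 0 < d i)
    (hAd : ∀ i, A.mulVec d i ≤ d i) :
    ∃ w : τ → ℝ, (∀ i, 0 ≤ w i) ∧ w ≠ 0 ∧ ∀ i, Matrix.vecMul w A i ≤ w i := by
  classical
  by_cases hne : A.mulVec d = d
  · have hsing : (1 - A).det = 0 := by
      refine Matrix.exists_mulVec_eq_zero_iff.1 ⟨d, fun h => ?_, ?_⟩
      · exact (hd (Classical.arbitrary τ)).ne' (congrFun h _)
      · rw [Matrix.sub_mulVec, Matrix.one_mulVec, hne, sub_self]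
    obtain ⟨v, hv0, hv⟩ := Matrix.exists_vecMul_eq_zero_iff.2 hsing
    rw [Matrix.vecMul_sub, Matrix.vecMul_one, sub_eq_zero] at hv
    refine ⟨fun i => |v i|, fun i => abs_nonneg _, fun h => hv0 (funext fun i => ?_), ?_⟩
    · exact abs_eq_zero.1 (congrFun h i)
    · have hge : ∀ j, |v j| ≤ Matrix.vecMul (fun i => |v i|) A j := fun j => by
        conv_lhs => rw [hv]
        refine (Finset.abs_sum_le_sum_abs _ _).trans (Finset.sum_le_sum fun i _ => ?_)
        rw [abs_mul, abs_of_nonneg (hA0 i j)]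
      have hsum : ∑ j, (Matrix.vecMul (fun i => |v i|) A j - |v j|) * d j = 0 := by
        have := Matrix.dotProduct_mulVec (fun i => |v i|) A d
        rw [hne] at this
        simp only [sub_mul, Finset.sum_sub_distrib]
        simp only [dotProduct] at this
        linarith
      intro j
      have := (Finset.sum_eq_zero_iff_of_nonneg fun j _ =>
        mul_nonneg (sub_nonneg.2 (hge j)) (hd j).le).1 hsum j (Finset.mem_univ j)
      rcases mul_eq_zero.1 this with h | h
      · linarith
      · exact absurd h (hd j).ne'
  · obtain ⟨w, hw0, hw⟩ := exists_vecMul_add_single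
      (fun u hu => nonneg_of_mulVec_le hE hA0 (fun _ _ => le_rfl) hA hd hAd hne hu)
      (Classical.arbitrary τ)
    have hle : ∀ i, Matrix.vecMul w A i + (Pi.single (Classical.arbitrary τ) 1 : τ → ℝ) i = w i :=
      fun i => (congrFun hw i).symm
    have hs : ∀ i, 0 ≤ (Pi.single (Classical.arbitrary τ) 1 : τ → ℝ) i := fun i =>
      (Pi.single_nonneg.2 zero_le_one : (0 : τ → ℝ) ≤ _) i
    refine ⟨w, hw0, fun h => ?_, fun i => by linarith [hle i, hs i]⟩
    have := hle (Classical.arbitrary τ)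
    simp [h] at this

/-- The Harnack inequality for left subinvariant vectors. -/
theorem pow_card_mul_le_of_vecMul_le {τ : Type*} [Fintype τ] {E : τ → τ → Prop}
    (hE : ∀ i j, Relation.ReflTransGen E i j) {A : Matrix τ τ ℝ} {a : ℝ} (ha0 : 0 ≤ a)
    (ha1 : a ≤ 1) (hA0 : ∀ i j, 0 ≤ A i j) (hA : ∀ i j, E i j → a ≤ A i j) {w : τ → ℝ}
    (hw : ∀ i, 0 ≤ w i) (hAw : ∀ i, Matrix.vecMul w A i ≤ w i) (i j : τ) :
    a ^ Fintype.card τ * w j ≤ w i := by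
  refine pow_card_mul_le_of_mulVec_le (E := Function.swap E) (A := A.transpose)
    (fun i j => Relation.reflTransGen_swap.2 (hE j i)) ha0 ha1 (fun i j => hA0 j i)
    (fun i j h => hA j i h) hw (fun i => ?_) i j
  rw [Matrix.mulVec_transpose]
  exact hAw i

/-! ### Rounding down -/

theorem roundDown_nonneg (h : ℕ) (t : ℝ) : 0 ≤ roundDown h t := by
  unfold roundDown
  have : (0 : ℤ) ≤ ⌊max t 0 * 2 ^ h⌋ := Int.floor_nonneg.2 (by positivity)
  have : (0 : ℝ) ≤ (⌊max t 0 * 2 ^ h⌋ : ℝ) := by exact_mod_cast this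
  positivity

theorem roundDown_le_max (h : ℕ) (t : ℝ) : roundDown h t ≤ max t 0 := by
  unfold roundDown
  rw [div_le_iff₀ (by positivity)]
  exact Int.floor_le _

theorem sub_le_roundDown (h : ℕ) (t : ℝ) : t - (2 ^ h)⁻¹ ≤ roundDown h t := by
  unfold roundDown
  have h2 : (0 : ℝ) < 2 ^ h := by positivity
  rw [le_div_iff₀ h2, sub_mul, inv_mul_cancel₀ h2.ne']
  have := Int.lt_floor_add_one (max t 0 * 2 ^ h)
  have : t * 2 ^ h ≤ max t 0 * 2 ^ h := by gcongr; exact le_max_left _ _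
  linarith

/-! ### Quadratic systems with non-negative coefficients -/

/-- A system `x = b + L x + (xᵀ s_i x)_i` with non-negative coefficients and symmetric matrices
`s_i`, in the variables `τ`. -/
structure QuadSystem (τ : Type*) where
  /-- The constants. -/
  b : τ → ℝ
  /-- The linear coefficients. -/
  L : Matrix τ τ ℝ
  /-- The quadratic coefficients, one symmetric matrix for each equation. -/
  s : τ → Matrix τ τ ℝ
  b_nonneg : ∀ i, 0 ≤ b i
  L_nonneg : ∀ i j, 0 ≤ L i j
  s_nonneg : ∀ i j k, 0 ≤ s i j k
  s_symm : ∀ i j k, s i j k = s i k j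

namespace QuadSystem

variable {τ : Type*} [Fintype τ]

/-- The right-hand side of a quadratic system. -/
noncomputable def map (Q : QuadSystem τ) (x : τ → ℝ) (i : τ) : ℝ :=
  Q.b i + Q.L.mulVec x i + x ⬝ᵥ (Q.s i).mulVec x

/-- The Jacobian matrix of the right-hand side of a quadratic system. -/
noncomputable def jac (Q : QuadSystem τ) (x : τ → ℝ) : Matrix τ τ ℝ :=
  Matrix.of fun i j => Q.L i j + 2 * (Q.s i).mulVec x j

/-- The Newton operator of a quadratic system. -/
noncomputable def newton [DecidableEq τ] (Q : QuadSystem τ) (x : τ → ℝ) : τ → ℝ :=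
  x + (1 - Q.jac x)⁻¹.mulVec (fun i => Q.map x i - x i)

theorem bil_comm (Q : QuadSystem τ) (i : τ) (x y : τ → ℝ) :
    x ⬝ᵥ (Q.s i).mulVec y = y ⬝ᵥ (Q.s i).mulVec x := by
  have : (Q.s i).transpose = Q.s i := by
    ext j k; exact Q.s_symm i k j
  rw [Matrix.dotProduct_mulVec, ← Matrix.mulVec_transpose, this, dotProduct_comm]

theorem s_mulVec_nonneg (Q : QuadSystem τ) (i : τ) {x : τ → ℝ} (hx : ∀ j, 0 ≤ x j) (j : τ) :
    0 ≤ (Q.s i).mulVec x j :=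
  Finset.sum_nonneg fun k _ => mul_nonneg (Q.s_nonneg i j k) (hx k)

theorem s_mulVec_mono (Q : QuadSystem τ) (i : τ) {x y : τ → ℝ} (hxy : ∀ j, x j ≤ y j) (j : τ) :
    (Q.s i).mulVec x j ≤ (Q.s i).mulVec y j :=
  Finset.sum_le_sum fun k _ => mul_le_mul_of_nonneg_left (hxy k) (Q.s_nonneg i j k)

theorem bil_nonneg (Q : QuadSystem τ) (i : τ) {x y : τ → ℝ} (hx : ∀ j, 0 ≤ x j)
    (hy : ∀ j, 0 ≤ y j) : 0 ≤ x ⬝ᵥ (Q.s i).mulVec y :=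
  Finset.sum_nonneg fun j _ => mul_nonneg (hx j) (Q.s_mulVec_nonneg i hy j)

theorem mul_le_bil (Q : QuadSystem τ) (i : τ) {x y : τ → ℝ} (hx : ∀ j, 0 ≤ x j)
    (hy : ∀ j, 0 ≤ y j) (j k : τ) : Q.s i j k * (x j * y k) ≤ x ⬝ᵥ (Q.s i).mulVec y := by
  have h1 : Q.s i j k * y k ≤ (Q.s i).mulVec y j :=
    Finset.single_le_sum (f := fun k => Q.s i j k * y k)
      (fun k _ => mul_nonneg (Q.s_nonneg i j k) (hy k)) (Finset.mem_univ k)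
  have h2 : x j * (Q.s i).mulVec y j ≤ x ⬝ᵥ (Q.s i).mulVec y :=
    Finset.single_le_sum (f := fun j => x j * (Q.s i).mulVec y j)
      (fun j _ => mul_nonneg (hx j) (Q.s_mulVec_nonneg i hy j)) (Finset.mem_univ j)
  nlinarith [mul_le_mul_of_nonneg_left h1 (hx j)]

theorem jac_mulVec (Q : QuadSystem τ) (x e : τ → ℝ) (i : τ) :
    (Q.jac x).mulVec e i = Q.L.mulVec e i + 2 * (e ⬝ᵥ (Q.s i).mulVec x) := by
  simp only [jac, Matrix.mulVec, dotProduct, Matrix.of_apply, Finset.mul_sum,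
    ← Finset.sum_add_distrib]
  refine Finset.sum_congr rfl fun j _ => ?_
  rw [← Finset.mul_sum, ← Finset.mul_sum, ← Finset.mul_sum]; ring

theorem jac_nonneg (Q : QuadSystem τ) {x : τ → ℝ} (hx : ∀ j, 0 ≤ x j) (i j : τ) :
    0 ≤ Q.jac x i j :=
  add_nonneg (Q.L_nonneg i j) (mul_nonneg zero_le_two (Q.s_mulVec_nonneg i hx j))

/-- The exact second order Taylor formula of a quadratic system. -/
theorem map_eq_taylor (Q : QuadSystem τ) (p x : τ → ℝ) (i : τ) :
    Q.map p i = Q.map x i + (Q.jac x).mulVec (p - x) i + (p - x) ⬝ᵥ (Q.s i).mulVec (p - x) := by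
  rw [jac_mulVec]
  simp only [map, Matrix.mulVec_sub, sub_dotProduct, dotProduct_sub, Pi.sub_apply]
  rw [Q.bil_comm i x p]; ring

theorem map_mono (Q : QuadSystem τ) {x y : τ → ℝ} (hx : ∀ i, 0 ≤ x i) (hxy : ∀ i, x i ≤ y i)
    (i : τ) : Q.map x i ≤ Q.map y i := by
  have hd : ∀ j, 0 ≤ (y - x) j := fun j => sub_nonneg.2 (hxy j)
  rw [Q.map_eq_taylor y x]
  have h1 : 0 ≤ (Q.jac x).mulVec (y - x) i :=
    Finset.sum_nonneg fun j _ => mul_nonneg (Q.jac_nonneg hx i j) (hd j)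
  linarith [Q.bil_nonneg i hd hd]

theorem map_zero_nonneg (Q : QuadSystem τ) (i : τ) : 0 ≤ Q.map 0 i := by
  simp [map, Q.b_nonneg i]

theorem continuous_map (Q : QuadSystem τ) : Continuous Q.map := by
  unfold map
  fun_prop

/-- The Newton step `N(x)` solves the linearised equations, so that its distance to an arbitrary
point `p` satisfies a linear system. -/
theorem sub_newton [DecidableEq τ] (Q : QuadSystem τ) {x : τ → ℝ} (hU : IsUnit (1 - Q.jac x))
    (p : τ → ℝ) (i : τ) :
    (p - Q.newton x) i = (Q.jac x).mulVec (p - Q.newton x) i + (p i - Q.map p i)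
      + (p - x) ⬝ᵥ (Q.s i).mulVec (p - x) := by
  have hdet := (Matrix.isUnit_iff_isUnit_det _).1 hU
  have h1 : (1 - Q.jac x).mulVec (Q.newton x - x) = fun i => Q.map x i - x i := by
    rw [newton, add_sub_cancel_left, Matrix.mulVec_mulVec, Matrix.mul_nonsing_inv _ hdet,
      Matrix.one_mulVec]
  have h2 := congrFun h1 i
  rw [Matrix.sub_mulVec, Matrix.one_mulVec] at h2
  have h3 := Q.map_eq_taylor p x i
  simp only [Matrix.mulVec_sub, Pi.sub_apply] at h2 h3 ⊢
  linarith

end QuadSystem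

/-- A monotone map of the order interval `[0, z]` to itself has a fixed point there. -/
theorem exists_fixedPoint_of_monotoneOn {τ : Type*} {f : (τ → ℝ) → τ → ℝ}
    {z : τ → ℝ} (hz : 0 ≤ z) (hf : ∀ x y, 0 ≤ x → x ≤ y → f x ≤ f y) (hf0 : 0 ≤ f 0)
    (hfz : f z ≤ z) : ∃ a, 0 ≤ a ∧ a ≤ z ∧ f a = a := by
  -- the infimum of all points `a ∈ [0, z]` with `f a ≤ a`
  let A : Set (τ → ℝ) := {a | 0 ≤ a ∧ a ≤ z ∧ f a ≤ a}
  have hzA : z ∈ A := ⟨hz, le_rfl, hfz⟩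
  have hbdd : BddBelow A := ⟨0, fun a ha => ha.1⟩
  let m : τ → ℝ := fun i => sInf ((fun a => a i) '' A)
  have hbi : ∀ i, BddBelow ((fun a => a i) '' A) := fun i =>
    ⟨0, by rintro _ ⟨a, ha, rfl⟩; exact ha.1 i⟩
  have hm_le : ∀ a ∈ A, m ≤ a := fun a ha i => csInf_le (hbi i) ⟨a, ha, rfl⟩
  have hle_m : ∀ c, (∀ a ∈ A, c ≤ a) → c ≤ m := fun c hc i =>
    le_csInf ⟨_, z, hzA, rfl⟩ (by rintro _ ⟨a, ha, rfl⟩; exact hc a ha i)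
  have hm0 : 0 ≤ m := hle_m 0 fun a ha => ha.1
  have hmz : m ≤ z := hm_le z hzA
  have hfm : f m ≤ m := hle_m _ fun a ha => (hf m a hm0 (hm_le a ha)).trans ha.2.2
  have hfm0 : 0 ≤ f m := hf0.trans (hf 0 m le_rfl hm0)
  exact ⟨m, hm0, hmz, le_antisymm hfm (hm_le _ ⟨hfm0, hfm.trans hmz, hf _ _ hfm0 hfm⟩)⟩

namespace QuadSystem

variable {τ : Type*} [Fintype τ]

/-- At the least fixed point `q` of a quadratic system, the Jacobian has a non-negative
subinvariant vector. It is a limit of the normalised differences `q - x_t`, where `x_t` is a fixed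
point of the damped system `x = t F(x)` and `t` tends to `1`. -/
theorem exists_jac_mulVec_le [Nonempty τ] (T : QuadSystem τ) {q : τ → ℝ} (hq : ∀ i, 0 < q i)
    (hfix : T.map q = q) (hmin : ∀ a, 0 ≤ a → a ≤ q → T.map a = a → a = q) :
    ∃ d : τ → ℝ, (∀ i, 0 ≤ d i) ∧ d ≠ 0 ∧ ∀ i, (T.jac q).mulVec d i ≤ d i := by
  have hq0 : 0 ≤ q := fun i => (hq i).le
  let t : ℕ → ℝ := fun n => 1 - 1 / ((n : ℝ) + 1 + 1)
  have ht0 : ∀ n, 0 ≤ t n := fun n => by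
    have : 1 / ((n : ℝ) + 1 + 1) ≤ 1 := by
      rw [div_le_one (by positivity)]; have := n.cast_nonneg (α := ℝ); linarith
    simpa [t] using this
  have ht1 : ∀ n, t n < 1 := fun n => by
    have : 0 < 1 / ((n : ℝ) + 1 + 1) := by positivity
    simpa [t] using this
  have htlim : Filter.Tendsto t Filter.atTop (nhds 1) := by
    have h1 := (Filter.tendsto_add_atTop_iff_nat 1).2 (tendsto_one_div_add_atTop_nhds_zero_nat (𝕜 := ℝ))
    have h2 := (tendsto_const_nhds (x := (1 : ℝ))).sub h1
    simpa [t] using h2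
  have hex : ∀ n, ∃ x, 0 ≤ x ∧ x ≤ q ∧ t n • T.map x = x := fun n =>
    exists_fixedPoint_of_monotoneOn (f := fun x => t n • T.map x) hq0
      (fun x y hx hxy i => mul_le_mul_of_nonneg_left (T.map_mono hx hxy i) (ht0 n))
      (fun i => mul_nonneg (ht0 n) (T.map_zero_nonneg i))
      (fun i => by
        simp only [hfix, Pi.smul_apply, smul_eq_mul]
        nlinarith [hq i, ht1 n])
  choose x hx0 hxq hxfix using hex
  have hmap0 : ∀ n i, 0 ≤ T.map (x n) i := fun n i =>
    (T.map_zero_nonneg i).trans (T.map_mono (fun _ => le_rfl) (hx0 n) i)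
  have hxF : ∀ n i, x n i ≤ T.map (x n) i := fun n i => by
    have := congrFun (hxfix n) i
    simp only [Pi.smul_apply, smul_eq_mul] at this
    nlinarith [hmap0 n i, ht1 n]
  have hne : ∀ n, q - x n ≠ 0 := fun n h => by
    have hxq' : x n = q := (sub_eq_zero.1 h).symm
    have := congrFun (hxfix n) (Classical.arbitrary τ)
    rw [hxq', hfix] at this
    simp only [Pi.smul_apply, smul_eq_mul] at this
    nlinarith [hq (Classical.arbitrary τ), ht1 n]
  let d : ℕ → τ → ℝ := fun n => ‖q - x n‖⁻¹ • (q - x n)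
  have hd1 : ∀ n, ‖d n‖ = 1 := fun n => by
    simp only [d, norm_smul, norm_inv, norm_norm]
    exact inv_mul_cancel₀ (norm_ne_zero_iff.2 (hne n))
  have hd0 : ∀ n i, 0 ≤ d n i := fun n i =>
    mul_nonneg (inv_nonneg.2 (norm_nonneg _)) (sub_nonneg.2 (hxq n i))
  have hdle : ∀ n i, (T.jac (x n)).mulVec (d n) i ≤ d n i := fun n i => by
    have hsub : ∀ j, 0 ≤ (q - x n) j := fun j => sub_nonneg.2 (hxq n j)
    have h1 := T.map_eq_taylor q (x n) i
    rw [hfix] at h1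
    have h2 := T.bil_nonneg i hsub hsub
    have h3 := hxF n i
    simp only [d, Matrix.mulVec_smul, Pi.smul_apply, smul_eq_mul]
    refine mul_le_mul_of_nonneg_left ?_ (inv_nonneg.2 (norm_nonneg _))
    rw [Pi.sub_apply]; linarith
  obtain ⟨⟨y, e⟩, hye, φ, hφ, hlim⟩ := ((isCompact_Icc (a := (0 : τ → ℝ)) (b := q)).prod
    (isCompact_sphere (0 : τ → ℝ) 1)).tendsto_subseq (x := fun n => (x n, d n))
    fun n => ⟨⟨hx0 n, hxq n⟩, by simp [hd1 n]⟩
  have hxlim : Filter.Tendsto (fun n => x (φ n)) Filter.atTop (nhds y) :=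
    (continuous_fst.tendsto _).comp hlim
  have hdlim : Filter.Tendsto (fun n => d (φ n)) Filter.atTop (nhds e) :=
    (continuous_snd.tendsto _).comp hlim
  have hyfix : T.map y = y := by
    have h1 : Filter.Tendsto (fun n => t (φ n) • T.map (x (φ n))) Filter.atTop
        (nhds ((1 : ℝ) • T.map y)) :=
      (htlim.comp hφ.tendsto_atTop).smul ((T.continuous_map.tendsto y).comp hxlim)
    simp only [hxfix, one_smul] at h1
    exact tendsto_nhds_unique h1 hxlim
  have hyq : y = q := hmin y hye.1.1 hye.1.2 hyfix
  have he1 : ‖e‖ = 1 := by simpa using hye.2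
  refine ⟨e, fun i => ?_, fun h => ?_, fun i => ?_⟩
  · exact ge_of_tendsto' ((continuous_apply i).tendsto _ |>.comp hdlim) fun n => hd0 (φ n) i
  · simp [h] at he1
  · have hcont : Continuous fun z : (τ → ℝ) × (τ → ℝ) => (T.jac z.1).mulVec z.2 i := by
      simp only [jac_mulVec]
      fun_prop
    have h1 := (hcont.tendsto (y, e)).comp hlim
    rw [hyq] at h1
    exact le_of_tendsto_of_tendsto' h1 ((continuous_apply i).tendsto _ |>.comp hdlim)
      fun n => hdle (φ n) i

end QuadSystem

namespace QuadSystem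

variable {τ : Type*} [Fintype τ]

/-! ### Perturbing a strongly connected quadratic system -/

theorem map_le_map_of_le {T Q : QuadSystem τ} (hs : Q.s = T.s) (hb : ∀ i, Q.b i ≤ T.b i)
    (hL : ∀ i j, Q.L i j ≤ T.L i j) {x : τ → ℝ} (hx : ∀ i, 0 ≤ x i) (i : τ) :
    Q.map x i ≤ T.map x i := by
  have h1 : Q.L.mulVec x i ≤ T.L.mulVec x i :=
    Finset.sum_le_sum fun j _ => mul_le_mul_of_nonneg_right (hL i j) (hx j)
  unfold map
  rw [hs]; linarith [hb i]

theorem jac_le_jac_of_le {T Q : QuadSystem τ} (hs : Q.s = T.s)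
    (hL : ∀ i j, Q.L i j ≤ T.L i j) {x y : τ → ℝ} (hxy : ∀ i, x i ≤ y i) (i j : τ) :
    Q.jac x i j ≤ T.jac y i j := by
  have := T.s_mulVec_mono i hxy j
  simp only [jac, Matrix.of_apply, hs]
  linarith [hL i j]

theorem mulVec_le_mulVec_of_le {A B : Matrix τ τ ℝ} (hBA : ∀ i j, B i j ≤ A i j) {v : τ → ℝ}
    (hv : ∀ i, 0 ≤ v i) (i : τ) : B.mulVec v i ≤ A.mulVec v i :=
  Finset.sum_le_sum fun j _ => mul_le_mul_of_nonneg_right (hBA i j) (hv j)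

theorem le_jac_of_edge (T : QuadSystem τ) {E : τ → τ → Prop} {q : τ → ℝ} (hq : ∀ i, 0 ≤ q i)
    {a : ℝ} (hG : ∀ i j, E i j → a ≤ T.L i j + (T.s i).mulVec q j) (i j : τ) (h : E i j) :
    a ≤ T.jac q i j := by
  have := T.s_mulVec_nonneg i hq j
  simp only [jac, Matrix.of_apply]
  linarith [hG i j h]

/-- In a nonlinear strongly connected system, lowering the lower coefficients such that the
residual at `q` is at most `η` moves the fixed point by `O(√η)`. Testing the equation for the
difference `e` with a left subinvariant vector of the Jacobian at `q` leaves only the quadratic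
term `s(e, e)`, which is thus `O(η)`, and by the Harnack inequality all `e i` are comparable. -/
theorem sq_sub_fixedPoint_le [Nonempty τ] {E : τ → τ → Prop}
    (hE : ∀ i j, Relation.ReflTransGen E i j) {T Q : QuadSystem τ} (hs : Q.s = T.s)
    (hb : ∀ i, Q.b i ≤ T.b i) (hL : ∀ i j, Q.L i j ≤ T.L i j) {q : τ → ℝ} (hq : ∀ i, 0 < q i)
    (hfix : T.map q = q) {a : ℝ} (ha0 : 0 < a) (ha1 : a ≤ 1)
    (hG : ∀ i j, E i j → a ≤ T.L i j + (T.s i).mulVec q j) (hnl : ∃ i j k, a ≤ T.s i j k)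
    {d : τ → ℝ} (hd : ∀ i, 0 < d i) (hAd : ∀ i, (T.jac q).mulVec d i ≤ d i)
    {η : ℝ} (hη : ∀ i, q i - Q.map q i ≤ η)
    {p : τ → ℝ} (hp0 : ∀ i, 0 ≤ p i) (hpq : ∀ i, p i ≤ q i) (hp : Q.map p = p) (i : τ) :
    a ^ (3 * Fintype.card τ + 1) * (q i - p i) ^ 2 ≤ Fintype.card τ * η := by
  have hq0 : ∀ i, 0 ≤ q i := fun i => (hq i).le
  obtain ⟨w, hw0, hwne, hw⟩ := exists_vecMul_le hE (T.jac_nonneg hq0)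
    (fun i j h => ha0.trans_le (T.le_jac_of_edge hq0 hG i j h)) hd hAd
  set e : τ → ℝ := q - p with he
  have he0 : ∀ i, 0 ≤ e i := fun i => sub_nonneg.2 (hpq i)
  -- lower bounds: all `e i` are comparable
  have heG : ∀ i, (Matrix.of fun i j => T.L i j + (T.s i).mulVec q j).mulVec e i ≤ e i := fun i => by
    have h1 : (Matrix.of fun i j => T.L i j + (T.s i).mulVec q j).mulVec e i
        = T.L.mulVec e i + e ⬝ᵥ (T.s i).mulVec q := by
      simp only [Matrix.mulVec, dotProduct, Matrix.of_apply, ← Finset.sum_add_distrib]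
      refine Finset.sum_congr rfl fun j _ => by ring
    have h2 : q i = T.b i + T.L.mulVec q i + q ⬝ᵥ (T.s i).mulVec q := (congrFun hfix i).symm
    have h3 : p i = Q.b i + Q.L.mulVec p i + p ⬝ᵥ (T.s i).mulVec p := by
      rw [← hs]; exact (congrFun hp i).symm
    have h4 := mulVec_le_mulVec_of_le hL hp0 i
    have h5 := T.bil_nonneg i he0 hp0
    rw [h1, he]
    rw [he] at h5
    simp only [Matrix.mulVec_sub, sub_dotProduct, Pi.sub_apply] at h5 ⊢
    rw [T.bil_comm i p q]
    rw [T.bil_comm i q p] at h5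
    rw [T.bil_comm i p q] at h5
    linarith [hb i]
  have hH := pow_card_mul_le_of_mulVec_le hE ha0.le ha1
    (fun i j => add_nonneg (T.L_nonneg i j) (T.s_mulVec_nonneg i hq0 j)) hG he0 heG
  have hHw := pow_card_mul_le_of_vecMul_le hE ha0.le ha1 (T.jac_nonneg hq0)
    (T.le_jac_of_edge hq0 hG) hw0 hw
  -- the tested equation
  have hee : ∀ i, e i + e ⬝ᵥ (T.s i).mulVec e ≤ η + (T.jac q).mulVec e i := fun i => by
    have h1 := Q.map_eq_taylor p q i
    have h2 := mulVec_le_mulVec_of_le (jac_le_jac_of_le hs hL (fun i => le_refl (q i))) he0 i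
    rw [hp, show p - q = -e by simp [he], Matrix.mulVec_neg, Matrix.mulVec_neg, neg_dotProduct,
      dotProduct_neg, neg_neg, Pi.neg_apply, hs] at h1
    have h3 : e i = q i - p i := rfl
    linarith [hη i]
  have htest : ∑ i, w i * (e ⬝ᵥ (T.s i).mulVec e) ≤ ∑ i, w i * η := by
    have h1 : ∑ i, w i * (e i + e ⬝ᵥ (T.s i).mulVec e)
        ≤ ∑ i, w i * (η + (T.jac q).mulVec e i) :=
      Finset.sum_le_sum fun i _ => mul_le_mul_of_nonneg_left (hee i) (hw0 i)
    have h2 : ∑ i, w i * (T.jac q).mulVec e i ≤ ∑ i, w i * e i := by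
      have := Matrix.dotProduct_mulVec w (T.jac q) e
      simp only [dotProduct] at this
      rw [this]
      exact Finset.sum_le_sum fun i _ => mul_le_mul_of_nonneg_right (hw i) (he0 i)
    simp only [mul_add, Finset.sum_add_distrib] at h1
    linarith
  obtain ⟨l, j, k, hljk⟩ := hnl
  set N := Fintype.card τ
  have hwl : 0 < w l := by
    obtain ⟨m, hm⟩ := Function.ne_iff.1 hwne
    exact lt_of_lt_of_le (mul_pos (pow_pos ha0 _) (lt_of_le_of_ne (hw0 m) (Ne.symm hm))) (hHw l m)
  have h1 : w l * (a * (e j * e k)) ≤ ∑ i, w i * (e ⬝ᵥ (T.s i).mulVec e) := by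
    refine le_trans (mul_le_mul_of_nonneg_left ?_ (hw0 l)) (Finset.single_le_sum
      (f := fun i => w i * (e ⬝ᵥ (T.s i).mulVec e))
      (fun i _ => mul_nonneg (hw0 i) (T.bil_nonneg i he0 he0)) (Finset.mem_univ l))
    exact (mul_le_mul_of_nonneg_right hljk (mul_nonneg (he0 j) (he0 k))).trans
      (T.mul_le_bil l he0 he0 j k)
  have hη0 : 0 ≤ η := by
    refine le_trans (sub_nonneg.2 ?_) (hη i)
    exact (map_le_map_of_le hs hb hL hq0 i).trans_eq (congrFun hfix i)
  have h2 : a ^ N * ∑ i, w i * η ≤ w l * (N * η) := by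
    rw [Finset.mul_sum]
    refine (Finset.sum_le_card_nsmul _ _ (w l * η) fun m _ => ?_).trans_eq ?_
    · rw [← mul_assoc]; exact mul_le_mul_of_nonneg_right (hHw l m) hη0
    · rw [Finset.card_univ, nsmul_eq_mul]; ring
  have h3 : a ^ N * (w l * (a * (e j * e k))) ≤ w l * (N * η) :=
    (mul_le_mul_of_nonneg_left (h1.trans htest) (pow_nonneg ha0.le N)).trans h2
  have h4 : a ^ N * (a * (e j * e k)) ≤ N * η := by
    refine le_of_mul_le_mul_left ?_ hwl
    linarith
  have h5 : (a ^ N * e i) * (a ^ N * e i) ≤ e j * e k :=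
    mul_le_mul (hH j i) (hH k i) (mul_nonneg (pow_nonneg ha0.le N) (he0 i)) (he0 j)
  calc a ^ (3 * N + 1) * (q i - p i) ^ 2
      = a ^ N * (a * ((a ^ N * e i) * (a ^ N * e i))) := by
        rw [show q i - p i = e i from rfl]; ring
    _ ≤ a ^ N * (a * (e j * e k)) := by gcongr
    _ ≤ _ := h4

/-! ### Newton's method with rounding on a strongly connected quadratic system -/

/-- At a point strictly below `q`, the Jacobian of a nonlinear system satisfies the maximum
principle. -/
theorem nonneg_of_jac_mulVec_le {E : τ → τ → Prop}
    (hE : ∀ i j, Relation.ReflTransGen E i j) {T Q : QuadSystem τ} (hs : Q.s = T.s)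
    (hL : ∀ i j, Q.L i j ≤ T.L i j) {q : τ → ℝ} {a : ℝ} (ha0 : 0 < a)
    (hG : ∀ i j, E i j → a ≤ T.L i j + (T.s i).mulVec q j) (hnl : ∃ i j k, a ≤ T.s i j k)
    {d : τ → ℝ} (hd : ∀ i, 0 < d i) (hAd : ∀ i, (T.jac q).mulVec d i ≤ d i)
    {x : τ → ℝ} (hx0 : ∀ i, 0 ≤ x i) (hxq : ∀ i, x i < q i) (u : τ → ℝ)
    (hu : ∀ i, (Q.jac x).mulVec u i ≤ u i) (i : τ) : 0 ≤ u i := by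
  refine nonneg_of_mulVec_le hE (Q.jac_nonneg hx0)
    (jac_le_jac_of_le hs hL fun i => (hxq i).le) (fun i j h => ha0.trans_le
      (T.le_jac_of_edge (fun i => (hx0 i).trans (hxq i).le) hG i j h)) hd hAd (fun heq => ?_) hu i
  obtain ⟨i, j, k, hijk⟩ := hnl
  have h1 := congrFun heq i
  have h2 := hAd i
  have h3 := mulVec_le_mulVec_of_le hL (fun i => (hd i).le) i
  have h4 := T.mul_le_bil i (fun i => (hd i).le) (y := q - x)
    (fun k => (sub_pos.2 (hxq k)).le) j k
  have h5 : 0 < T.s i j k * (d j * (q - x) k) :=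
    mul_pos (ha0.trans_le hijk) (mul_pos (hd j) (sub_pos.2 (hxq k)))
  rw [jac_mulVec] at h1 h2
  rw [Matrix.mulVec_sub, dotProduct_sub] at h4
  rw [hs] at h1
  linarith

/-- A Newton step in a nonlinear strongly connected system stays strictly below `q`: the set of
coordinates in which the step reaches `q` is closed under the edges of the dependency graph and
avoids the equations with a quadratic term. -/
theorem newton_lt [DecidableEq τ] {E : τ → τ → Prop}
    (hE : ∀ i j, Relation.ReflTransGen E i j) {T Q : QuadSystem τ} (hs : Q.s = T.s)
    (hb : ∀ i, Q.b i ≤ T.b i) (hL : ∀ i j, Q.L i j ≤ T.L i j) {q : τ → ℝ}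
    (hfix : T.map q = q) {a : ℝ} (ha0 : 0 < a)
    (hG : ∀ i j, E i j → a ≤ T.L i j + (T.s i).mulVec q j) (hnl : ∃ i j k, a ≤ T.s i j k)
    (hpos : ∀ i j, E i j → 0 < Q.L i j ∨ Q.map q i < q i ∨ ∃ k, 0 < Q.s i j k)
    {d : τ → ℝ} (hd : ∀ i, 0 < d i) (hAd : ∀ i, (T.jac q).mulVec d i ≤ d i)
    {x : τ → ℝ} (hx0 : ∀ i, 0 ≤ x i) (hxq : ∀ i, x i < q i) (i : τ) :
    Q.newton x i < q i := by
  have hmono := nonneg_of_jac_mulVec_le hE hs hL ha0 hG hnl hd hAd hx0 hxq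
  have hq0 : ∀ i, 0 ≤ q i := fun i => (hx0 i).trans (hxq i).le
  have hsub : ∀ i, 0 < (q - x) i := fun i => sub_pos.2 (hxq i)
  have hN := Q.sub_newton (isUnit_one_sub_of_monotone hmono) q
  have hu : ∀ i, 0 ≤ q i - Q.map q i := fun i => sub_nonneg.2
    ((map_le_map_of_le hs hb hL hq0 i).trans_eq (congrFun hfix i))
  have hss : ∀ i, 0 ≤ (q - x) ⬝ᵥ (Q.s i).mulVec (q - x) := fun i =>
    Q.bil_nonneg i (fun i => (hsub i).le) (fun i => (hsub i).le)
  have hv0 : ∀ i, 0 ≤ (q - Q.newton x) i :=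
    hmono _ fun i => by linarith [hN i, hu i, hss i]
  by_contra! hi
  have hJ : ∀ m l, Q.jac x m l * (q - Q.newton x) l ≤ (Q.jac x).mulVec (q - Q.newton x) m :=
    fun m l => Finset.single_le_sum (f := fun l => Q.jac x m l * (q - Q.newton x) l)
      (fun l _ => mul_nonneg (Q.jac_nonneg hx0 m l) (hv0 l)) (Finset.mem_univ l)
  have hspos : ∀ m l k, 0 < Q.s m l k → 0 < (q - x) ⬝ᵥ (Q.s m).mulVec (q - x) := fun m l k hk =>
    lt_of_lt_of_le (mul_pos hk (mul_pos (hsub l) (hsub k)))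
      (Q.mul_le_bil m (fun i => (hsub i).le) (fun i => (hsub i).le) l k)
  have hJ0 : ∀ m, 0 ≤ (Q.jac x).mulVec (q - Q.newton x) m := fun m =>
    Finset.sum_nonneg fun l _ => mul_nonneg (Q.jac_nonneg hx0 m l) (hv0 l)
  have hall : ∀ m, (q - Q.newton x) m = 0 := by
    refine mem_of_closed_of_strongConn hE (i₀ := i)
      (le_antisymm (by rw [Pi.sub_apply]; linarith) (hv0 i)) fun m l hm hml => ?_
    have h0 := hN m
    rw [hm] at h0
    rcases hpos m l hml with h | h | ⟨k, h⟩
    · have h1 := hJ m l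
      have h2 : 0 < Q.jac x m l :=
        add_pos_of_pos_of_nonneg h (mul_nonneg zero_le_two (Q.s_mulVec_nonneg m hx0 l))
      by_contra hne
      have := mul_pos h2 (lt_of_le_of_ne (hv0 l) (Ne.symm hne))
      linarith [hu m, hss m]
    · linarith [hJ0 m, hss m]
    · linarith [hJ0 m, hu m, hspos m l k h]
  obtain ⟨m, l, k, hmlk⟩ := hnl
  have h0 := hN m
  rw [hall m] at h0
  have := hspos m l k (by rw [hs]; exact ha0.trans_le hmlk)
  linarith [hJ0 m, hu m]

/-- Newton's method with rounding on a nonlinear strongly connected system `Q`, compared with the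
least fixed point `q` of a larger system `T`. The summand `ρ` accounts for the difference of the
systems, the other one for Newton's method: its error in the norm weighted by a positive
subinvariant vector of the Jacobian at `q` is halved by each step, up to rounding. -/
theorem nonlinear_newton_error [Nonempty τ] [DecidableEq τ] {E : τ → τ → Prop}
    (hE : ∀ i j, Relation.ReflTransGen E i j) {T Q : QuadSystem τ} (hs : Q.s = T.s)
    (hb : ∀ i, Q.b i ≤ T.b i) (hL : ∀ i j, Q.L i j ≤ T.L i j) {q : τ → ℝ} (hq : ∀ i, 0 < q i)
    (hq1 : ∀ i, q i ≤ 1) (hfix : T.map q = q)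
    (hmin : ∀ a, 0 ≤ a → a ≤ q → T.map a = a → a = q) {a : ℝ} (ha0 : 0 < a) (ha1 : a ≤ 1)
    (hG : ∀ i j, E i j → a ≤ T.L i j + (T.s i).mulVec q j) (hnl : ∃ i j k, a ≤ T.s i j k)
    (hpos : ∀ i j, E i j → 0 < Q.L i j ∨ Q.map q i < q i ∨ ∃ k, 0 < Q.s i j k)
    {η : ℝ} (hη : ∀ i, q i - Q.map q i ≤ η) {h : ℕ} {x : ℕ → τ → ℝ} (hx0 : x 0 = 0)
    (hx : ∀ k i, x (k + 1) i = roundDown h (Q.newton (x k) i)) :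
    (∀ k, IsUnit (1 - Q.jac (x k))) ∧ (∀ k i, 0 ≤ x k i ∧ x k i ≤ q i) ∧
    ∃ ρ, a ^ (3 * Fintype.card τ + 1) * ρ ^ 2 ≤ Fintype.card τ * η ∧
      ∀ g, h ≤ g + 1 → ∀ i,
        a ^ Fintype.card τ * (q i - x g i - ρ) ≤ 4 * (2 ^ h)⁻¹ := by
  have hq0 : ∀ i, 0 ≤ q i := fun i => (hq i).le
  set N := Fintype.card τ
  -- a positive subinvariant vector `d` with smallest coordinate `1`
  obtain ⟨d, hd1, hAd, hda⟩ : ∃ d : τ → ℝ, (∀ i, 1 ≤ d i) ∧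
      (∀ i, (T.jac q).mulVec d i ≤ d i) ∧ ∀ i, a ^ N * d i ≤ 1 := by
    obtain ⟨d, hd0, hdne, hAd⟩ := T.exists_jac_mulVec_le hq hfix hmin
    have hH := pow_card_mul_le_of_mulVec_le hE ha0.le ha1 (T.jac_nonneg hq0)
      (T.le_jac_of_edge hq0 hG) hd0 hAd
    obtain ⟨m, -, hm⟩ := Finset.exists_min_image Finset.univ d Finset.univ_nonempty
    have hdm : 0 < d m := by
      obtain ⟨l, hl⟩ := Function.ne_iff.1 hdne
      exact lt_of_lt_of_le (mul_pos (pow_pos ha0 _) (lt_of_le_of_ne (hd0 l) (Ne.symm hl))) (hH m l)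
    refine ⟨(d m)⁻¹ • d, fun i => ?_, fun i => ?_, fun i => ?_⟩
    · simp only [Pi.smul_apply, smul_eq_mul]
      rw [inv_mul_eq_div, one_le_div hdm]; exact hm i (Finset.mem_univ i)
    · simp only [Matrix.mulVec_smul, Pi.smul_apply, smul_eq_mul]
      exact mul_le_mul_of_nonneg_left (hAd i) (inv_nonneg.2 hdm.le)
    · simp only [Pi.smul_apply, smul_eq_mul]
      rw [inv_mul_eq_div, mul_div_assoc', div_le_one hdm]; exact hH m i
  have hd : ∀ i, 0 < d i := fun i => lt_of_lt_of_le one_pos (hd1 i)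
  have hxq : ∀ k i, 0 ≤ x k i ∧ x k i < q i := fun k => by
    induction k with
    | zero => exact fun i => by simp [hx0, hq i]
    | succ k ih =>
      intro i
      rw [hx]
      refine ⟨roundDown_nonneg h _, (roundDown_le_max h _).trans_lt (max_lt ?_ (hq i))⟩
      exact newton_lt hE hs hb hL hfix ha0 hG hnl hpos hd hAd (fun i => (ih i).1)
        (fun i => (ih i).2) i
  have hmono := fun k => nonneg_of_jac_mulVec_le hE hs hL ha0 hG hnl hd hAd
    (fun i => (hxq k i).1) (fun i => (hxq k i).2)
  have hU := fun k => isUnit_one_sub_of_monotone (hmono k)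
  refine ⟨hU, fun k i => ⟨(hxq k i).1, (hxq k i).2.le⟩, ?_⟩
  obtain ⟨p, hp0, hpq, hp⟩ := exists_fixedPoint_of_monotoneOn (f := Q.map) (z := q) hq0
    (fun x y hx hxy => Q.map_mono hx hxy) Q.map_zero_nonneg
    (fun i => (map_le_map_of_le hs hb hL hq0 i).trans_eq (congrFun hfix i))
  -- the coefficients `l k` bound the error with respect to the fixed point `p` of `Q`
  let l : ℕ → ℝ := fun k => (2 ^ k)⁻¹ + 2 * (1 - (2 ^ k)⁻¹) * (2 ^ h)⁻¹
  have hl : ∀ k, l (k + 1) = l k / 2 + (2 ^ h)⁻¹ := fun k => by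
    simp only [l, pow_succ, mul_inv]; ring
  have hxp : ∀ k i, x k i ≤ p i ∧ p i - x k i ≤ l k * d i := fun k => by
    induction k with
    | zero =>
      intro i
      refine ⟨by simpa [hx0] using hp0 i, ?_⟩
      simp only [hx0, l, Pi.zero_apply, sub_zero, pow_zero, inv_one, sub_self, mul_zero, zero_mul,
        add_zero, one_mul]
      exact ((hpq i).trans (hq1 i)).trans (hd1 i)
    | succ k ih =>
      have he : ∀ i, 0 ≤ (p - x k) i := fun i => sub_nonneg.2 (ih i).1
      have hN := Q.sub_newton (hU k) p
      have hN0 : ∀ i, 0 ≤ (p - Q.newton (x k)) i := hmono k _ fun i => by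
        have := hN i
        rw [hp] at this
        linarith [Q.bil_nonneg i he he]
      have hN1 : ∀ i, 0 ≤ ((l k / 2) • d - (p - Q.newton (x k))) i := hmono k _ fun i => by
        have h1 := hN i
        have h2 : (p - x k) ⬝ᵥ (Q.s i).mulVec (p - x k)
            ≤ l k / 2 * (d i - (Q.jac (x k)).mulVec d i) := by
          have h3 : (Q.jac p).mulVec d i ≤ d i :=
            (mulVec_le_mulVec_of_le (jac_le_jac_of_le hs hL hpq) (fun i => (hd i).le) i).trans
              (hAd i)
          have hlk : 0 ≤ l k := by
            have h4 := (he i).trans (ih i).2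
            by_contra! hneg
            nlinarith [hd i]
          have h5 : (p - x k) ⬝ᵥ (Q.s i).mulVec (p - x k)
              ≤ l k * (d ⬝ᵥ (Q.s i).mulVec (p - x k)) := by
            rw [← smul_eq_mul, ← smul_dotProduct]
            exact Finset.sum_le_sum fun j _ => mul_le_mul_of_nonneg_right (ih j).2
              (Q.s_mulVec_nonneg i he j)
          have h6 : 2 * (d ⬝ᵥ (Q.s i).mulVec (p - x k))
              = (Q.jac p).mulVec d i - (Q.jac (x k)).mulVec d i := by
            rw [jac_mulVec, jac_mulVec, Matrix.mulVec_sub, dotProduct_sub]; ring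
          nlinarith [mul_le_mul_of_nonneg_left h3 hlk]
        rw [hp, sub_self, add_zero] at h1
        rw [Matrix.mulVec_sub, Matrix.mulVec_smul, Pi.sub_apply, Pi.smul_apply, smul_eq_mul,
          Pi.sub_apply ((l k / 2) • d), Pi.smul_apply, smul_eq_mul]
        linarith
      intro i
      have h1 := hN0 i
      have h2 := hN1 i
      simp only [Pi.sub_apply, Pi.smul_apply, smul_eq_mul] at h1 h2
      rw [hx, hl]
      refine ⟨(roundDown_le_max h _).trans (max_le (by linarith) (hp0 i)), ?_⟩
      have h3 := sub_le_roundDown h (Q.newton (x k) i)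
      have h4 : (0 : ℝ) ≤ (2 ^ h)⁻¹ := by positivity
      nlinarith [hd1 i]
  obtain ⟨m, -, hm⟩ := Finset.exists_max_image Finset.univ (fun i => q i - p i)
    Finset.univ_nonempty
  refine ⟨q m - p m, sq_sub_fixedPoint_le hE hs hb hL hq hfix ha0 ha1 hG
    hnl hd hAd hη hp0 hpq hp m, fun g hg i => ?_⟩
  have h1 : (2 ^ g : ℝ)⁻¹ ≤ 2 * (2 ^ h)⁻¹ := by
    rw [← div_eq_mul_inv, le_div_iff₀ (by positivity), inv_mul_le_iff₀ (by positivity),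
      ← pow_succ]
    exact pow_le_pow_right₀ one_le_two hg
  have h2 : l g ≤ 4 * (2 ^ h)⁻¹ := by
    have h3 : (0 : ℝ) ≤ (2 ^ g)⁻¹ * (2 ^ h)⁻¹ := by positivity
    simp only [l]; linarith
  have h3 : q i - x g i - (q m - p m) ≤ l g * d i := by
    linarith [(hxp g i).2, hm i (Finset.mem_univ i)]
  calc a ^ N * (q i - x g i - (q m - p m)) ≤ a ^ N * (l g * d i) := by gcongr
    _ ≤ a ^ N * (4 * (2 ^ h)⁻¹ * d i) := by gcongr; exact (hd i).le
    _ = 4 * (2 ^ h)⁻¹ * (a ^ N * d i) := by ring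
    _ ≤ 4 * (2 ^ h)⁻¹ * 1 := by gcongr; exact hda i
    _ = _ := mul_one _

/-- One Newton step from `0`, rounded down, on a linear strongly connected system `Q`, compared with
the solution `q` of a larger linear system `T`. The entries of a row `w` of `(1 - T.L)⁻¹` are
comparable by the Harnack inequality, and `w ⬝ᵥ T.b = q i ≤ 1` bounds one of them. -/
theorem linear_newton_error [DecidableEq τ] {E : τ → τ → Prop}
    (hE : ∀ i j, Relation.ReflTransGen E i j) {T Q : QuadSystem τ} (hs : Q.s = T.s)
    (hb : ∀ i, Q.b i ≤ T.b i) (hL : ∀ i j, Q.L i j ≤ T.L i j) {q : τ → ℝ} (hq : ∀ i, 0 < q i)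
    (hq1 : ∀ i, q i ≤ 1) (hfix : T.map q = q) {a : ℝ} (ha0 : 0 < a) (ha1 : a ≤ 1)
    (hG : ∀ i j, E i j → a ≤ T.L i j + (T.s i).mulVec q j) (hlin : ∀ i j k, T.s i j k = 0)
    {β : ℝ} (hβ : 0 < β) (hTb : ∃ j, β ≤ T.b j)
    {η : ℝ} (hη : ∀ i, q i - Q.map q i ≤ η) (h : ℕ) :
    IsUnit (1 - Q.jac 0) ∧ ∀ i, roundDown h (Q.newton 0 i) ≤ q i ∧
      a ^ Fintype.card τ * β * (q i - roundDown h (Q.newton 0 i) - (2 ^ h)⁻¹)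
        ≤ Fintype.card τ * η := by
  have hq0 : ∀ i, 0 ≤ q i := fun i => (hq i).le
  have hbil : ∀ i (x y : τ → ℝ), x ⬝ᵥ (Q.s i).mulVec y = 0 := fun i x y => by
    rw [hs, show T.s i = 0 from Matrix.ext (hlin i)]; simp
  obtain ⟨j, hj⟩ := hTb
  have hqA : ∀ i, q i = T.b i + (T.jac q).mulVec q i := fun i => by
    rw [jac_mulVec, ← hs, hbil]
    conv_lhs => rw [← hfix]
    rw [map, ← hs, hbil]; ring
  have hAq : ∀ i, (T.jac q).mulVec q i ≤ q i := fun i => by linarith [hqA i, T.b_nonneg i]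
  have hApos : ∀ i k, E i k → 0 < T.jac q i k := fun i k h =>
    ha0.trans_le (T.le_jac_of_edge hq0 hG i k h)
  have hJle : ∀ i j, Q.jac 0 i j ≤ T.jac q i j := jac_le_jac_of_le hs hL hq0
  have hlt : (T.jac q).mulVec q j < q j := by linarith [hqA j]
  have hJne : (Q.jac 0).mulVec q ≠ q := fun heq => by
    have h1 := mulVec_le_mulVec_of_le hJle hq0 j
    have h2 := congrFun heq j
    linarith
  have hmono := fun u => nonneg_of_mulVec_le (u := u) hE
    (Q.jac_nonneg (x := 0) fun _ => le_rfl) hJle hApos hq hAq hJne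
  have hmonoA := fun u => nonneg_of_mulVec_le (u := u) hE (T.jac_nonneg hq0) (fun _ _ => le_rfl)
    hApos hq hAq (fun heq => hlt.ne (congrFun heq j))
  have hU := isUnit_one_sub_of_monotone hmono
  refine ⟨hU, fun i => ?_⟩
  have hu : ∀ i, 0 ≤ q i - Q.map q i := fun i => sub_nonneg.2
    ((map_le_map_of_le hs hb hL hq0 i).trans_eq (congrFun hfix i))
  set v := q - Q.newton 0 with hv
  have hN : ∀ i, v i = (Q.jac 0).mulVec v i + (q i - Q.map q i) := fun i => by
    have := Q.sub_newton hU q i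
    rwa [hbil, add_zero] at this
  have hv0 : ∀ i, 0 ≤ v i := hmono v fun i => by linarith [hN i, hu i]
  have hvi : v i = q i - Q.newton 0 i := rfl
  have hvq : Q.newton 0 i ≤ q i := by linarith [hv0 i]
  refine ⟨(roundDown_le_max h _).trans (max_le hvq (hq0 i)), ?_⟩
  obtain ⟨w, hw0, hw⟩ := exists_vecMul_add_single hmonoA i
  have hη0 : 0 ≤ η := (hu i).trans (hη i)
  have hwA : ∀ k, Matrix.vecMul w (T.jac q) k ≤ w k := fun k => by
    have h1 := congrFun hw k
    have h2 : 0 ≤ (Pi.single i 1 : τ → ℝ) k :=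
      (Pi.single_nonneg.2 zero_le_one : (0 : τ → ℝ) ≤ _) k
    rw [Pi.add_apply] at h1
    linarith
  have hdot : ∀ y : τ → ℝ, w ⬝ᵥ y = w ⬝ᵥ (T.jac q).mulVec y + y i := fun y => by
    conv_lhs => rw [hw]
    rw [add_dotProduct, single_dotProduct, one_mul, Matrix.dotProduct_mulVec]
  have hwb : w ⬝ᵥ T.b = q i := by
    have h1 := hdot q
    have h2 : q = T.b + (T.jac q).mulVec q := funext hqA
    have h3 : w ⬝ᵥ q = w ⬝ᵥ T.b + w ⬝ᵥ (T.jac q).mulVec q := by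
      rw [← dotProduct_add, ← h2]
    linarith
  have hwj : w j * β ≤ 1 := by
    calc w j * β ≤ w j * T.b j := mul_le_mul_of_nonneg_left hj (hw0 j)
      _ ≤ w ⬝ᵥ T.b := Finset.single_le_sum (f := fun k => w k * T.b k)
        (fun k _ => mul_nonneg (hw0 k) (T.b_nonneg k)) (Finset.mem_univ j)
      _ ≤ 1 := hwb.trans_le (hq1 i)
  have hHw := pow_card_mul_le_of_vecMul_le hE ha0.le ha1 (T.jac_nonneg hq0)
    (T.le_jac_of_edge hq0 hG) hw0 hwA
  have hvw : v i ≤ ∑ k, w k * η := by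
    have h1 : w ⬝ᵥ v ≤ ∑ k, w k * ((T.jac q).mulVec v k + η) :=
      Finset.sum_le_sum fun k _ => mul_le_mul_of_nonneg_left
        (by linarith [hN k, hη k, mulVec_le_mulVec_of_le hJle hv0 k]) (hw0 k)
    simp only [mul_add, Finset.sum_add_distrib] at h1
    have h2 := hdot v
    simp only [dotProduct] at h1 h2
    linarith
  have hsum : a ^ Fintype.card τ * β * ∑ k, w k * η ≤ Fintype.card τ * η := by
    rw [Finset.mul_sum]
    refine (Finset.sum_le_card_nsmul _ _ η fun k _ => ?_).trans_eq
      (by rw [Finset.card_univ, nsmul_eq_mul])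
    have h1 : a ^ Fintype.card τ * w k * β ≤ 1 :=
      (mul_le_mul_of_nonneg_right (hHw j k) hβ.le).trans hwj
    calc a ^ Fintype.card τ * β * (w k * η) = a ^ Fintype.card τ * w k * β * η := by ring
      _ ≤ 1 * η := by gcongr
      _ = η := one_mul η
  refine le_trans (mul_le_mul_of_nonneg_left ?_ (by positivity)) hsum
  linarith [sub_le_roundDown h (Q.newton 0 i)]

end QuadSystem

/-! ### Quadratic polynomials as quadratic systems -/

/-- The polynomial `p` is `c + l x + xᵀ s x`, with non-negative coefficients and a symmetric matrix
`s`. Its non-zero coefficients are at least `μ`; as the off-diagonal entries of `s` are halves of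
coefficients of `p`, those of `s` are only at least `μ / 2`. -/
structure IsQuadForm {σ : Type*} [Fintype σ] (μ : ℝ) (p : MvPolynomial σ ℝ) (c : ℝ) (l : σ → ℝ)
    (s : Matrix σ σ ℝ) : Prop where
  c_nonneg : 0 ≤ c
  l_nonneg : ∀ j, 0 ≤ l j
  s_nonneg : ∀ j k, 0 ≤ s j k
  s_symm : ∀ j k, s j k = s k j
  eval_eq : ∀ x, eval x p = c + l ⬝ᵥ x + x ⬝ᵥ s.mulVec x
  eval_pderiv : ∀ x j, eval x (pderiv j p) = l j + 2 * s.mulVec x j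
  le_c : c ≠ 0 → μ ≤ c
  le_l : ∀ j, l j ≠ 0 → μ ≤ l j
  le_s : ∀ j k, s j k ≠ 0 → μ ≤ 2 * s j k
  ne_zero_of_mem_vars : ∀ j ∈ p.vars, l j ≠ 0 ∨ ∃ k, s j k ≠ 0

theorem IsQuadForm.zero {σ : Type*} [Fintype σ] (μ : ℝ) :
    IsQuadForm μ (0 : MvPolynomial σ ℝ) 0 0 0 where
  c_nonneg := le_rfl
  l_nonneg _ := le_rfl
  s_nonneg _ _ := le_rfl
  s_symm _ _ := rfl
  eval_eq x := by simp
  eval_pderiv x j := by simp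
  le_c h := absurd rfl h
  le_l _ h := absurd rfl h
  le_s _ _ h := absurd rfl h
  ne_zero_of_mem_vars j h := by simp at h

theorem IsQuadForm.add {σ : Type*} [Fintype σ] {μ : ℝ} {p p' : MvPolynomial σ ℝ} {c c' : ℝ}
    {l l' : σ → ℝ} {s s' : Matrix σ σ ℝ} (h : IsQuadForm μ p c l s)
    (h' : IsQuadForm μ p' c' l' s') : IsQuadForm μ (p + p') (c + c') (l + l') (s + s') := by
  classical
  have low : ∀ {a b : ℝ}, 0 ≤ a → 0 ≤ b → (a ≠ 0 → μ ≤ a) → (b ≠ 0 → μ ≤ b) → a + b ≠ 0 →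
      μ ≤ a + b := fun {a b} ha hb hla hlb hab => by
    by_cases h0 : a = 0
    · subst h0; rw [zero_add] at hab ⊢; exact hlb hab
    · linarith [hla h0]
  have pos : ∀ {a b : ℝ}, 0 ≤ a → 0 ≤ b → (a ≠ 0 ∨ b ≠ 0) → a + b ≠ 0 := fun {a b} ha hb hab h0 => by
    rcases hab with h | h <;> apply h <;> linarith
  exact
  { c_nonneg := add_nonneg h.c_nonneg h'.c_nonneg
    l_nonneg := fun j => add_nonneg (h.l_nonneg j) (h'.l_nonneg j)
    s_nonneg := fun j k => add_nonneg (h.s_nonneg j k) (h'.s_nonneg j k)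
    s_symm := fun j k => by rw [Matrix.add_apply, Matrix.add_apply, h.s_symm, h'.s_symm]
    eval_eq := fun x => by
      rw [map_add, h.eval_eq, h'.eval_eq, add_dotProduct, Matrix.add_mulVec, dotProduct_add]; ring
    eval_pderiv := fun x j => by
      rw [map_add, map_add, h.eval_pderiv, h'.eval_pderiv, Matrix.add_mulVec, Pi.add_apply,
        Pi.add_apply]
      ring
    le_c := low h.c_nonneg h'.c_nonneg h.le_c h'.le_c
    le_l := fun j => low (h.l_nonneg j) (h'.l_nonneg j) (h.le_l j) (h'.le_l j)
    le_s := fun j k hjk => by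
      have h1 := h.s_nonneg j k
      have h2 := h'.s_nonneg j k
      rw [Matrix.add_apply] at hjk ⊢
      rw [mul_add]
      refine low (by linarith) (by linarith) (fun hn => h.le_s j k fun h0 => hn (by simp [h0]))
        (fun hn => h'.le_s j k fun h0 => hn (by simp [h0])) (by rw [← mul_add]; simpa using hjk)
    ne_zero_of_mem_vars := fun j hj => by
      rcases Finset.mem_union.1 (vars_add_subset p p' hj) with hj | hj
      · rcases h.ne_zero_of_mem_vars j hj with h1 | ⟨k, h1⟩
        · exact Or.inl (pos (h.l_nonneg j) (h'.l_nonneg j) (Or.inl h1))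
        · exact Or.inr ⟨k, pos (h.s_nonneg j k) (h'.s_nonneg j k) (Or.inl h1)⟩
      · rcases h'.ne_zero_of_mem_vars j hj with h1 | ⟨k, h1⟩
        · exact Or.inl (pos (h.l_nonneg j) (h'.l_nonneg j) (Or.inr h1))
        · exact Or.inr ⟨k, pos (h.s_nonneg j k) (h'.s_nonneg j k) (Or.inr h1)⟩ }

theorem isQuadForm_C {σ : Type*} [Fintype σ] {μ a : ℝ} (ha0 : 0 ≤ a) (ha : μ ≤ a) :
    IsQuadForm μ (C a : MvPolynomial σ ℝ) a 0 0 where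
  c_nonneg := ha0
  l_nonneg _ := le_rfl
  s_nonneg _ _ := le_rfl
  s_symm _ _ := rfl
  eval_eq x := by simp
  eval_pderiv x j := by simp
  le_c _ := ha
  le_l _ h := absurd rfl h
  le_s _ _ h := absurd rfl h
  ne_zero_of_mem_vars j h := by simp at h

theorem isQuadForm_C_mul_X {σ : Type*} [Fintype σ] [DecidableEq σ] {μ a : ℝ} (ha0 : 0 < a)
    (ha : μ ≤ a) (i : σ) :
    IsQuadForm μ (C a * X i : MvPolynomial σ ℝ) 0 (Pi.single i a) 0 where
  c_nonneg := le_rfl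
  l_nonneg j := (Pi.single_nonneg.2 ha0.le : (0 : σ → ℝ) ≤ _) j
  s_nonneg _ _ := le_rfl
  s_symm _ _ := rfl
  eval_eq x := by simp
  eval_pderiv x j := by
    rw [pderiv_C_mul, pderiv_X, map_mul, eval_C, Pi.single_apply, Pi.single_apply]
    by_cases h : i = j <;> simp [h, eq_comm (a := j)]
  le_c h := absurd rfl h
  le_l j h := by
    rw [Pi.single_apply] at h ⊢
    split_ifs at h ⊢ with h1
    · exact ha
    · exact absurd rfl h
  le_s _ _ h := absurd rfl h
  ne_zero_of_mem_vars j h := by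
    rw [vars_C_mul _ ha0.ne', vars_X, Finset.mem_singleton] at h
    left; simp [h, ha0.ne']

theorem single_mulVec_eq_single {σ : Type*} [Fintype σ] [DecidableEq σ] (i k : σ) (a : ℝ)
    (x : σ → ℝ) : (Matrix.single i k a).mulVec x = Pi.single i (a * x k) :=
  Matrix.single_mulVec i k a x

theorem isQuadForm_C_mul_X_mul_X {σ : Type*} [Fintype σ] [DecidableEq σ] {μ a : ℝ} (ha0 : 0 < a)
    (ha : μ ≤ a) (i k : σ) :
    IsQuadForm μ (C a * (X i * X k) : MvPolynomial σ ℝ) 0 0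
      (Matrix.single i k (a / 2) + Matrix.single k i (a / 2)) where
  c_nonneg := le_rfl
  l_nonneg _ := le_rfl
  s_nonneg j m := by
    simp only [Matrix.add_apply, Matrix.single_apply]
    split_ifs <;> linarith
  s_symm j m := by
    simp only [Matrix.add_apply, Matrix.single_apply]
    rw [add_comm]
    simp only [and_comm]
  eval_eq x := by
    rw [Matrix.add_mulVec, single_mulVec_eq_single, single_mulVec_eq_single, dotProduct_add,
      dotProduct_single, dotProduct_single, zero_dotProduct]
    simp only [map_mul, eval_C, eval_X]
    ring
  eval_pderiv x j := by
    rw [Matrix.add_mulVec, single_mulVec_eq_single, single_mulVec_eq_single, Pi.add_apply,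
      pderiv_C_mul, pderiv_mul, pderiv_X, pderiv_X, Pi.single_apply, Pi.single_apply,
      Pi.single_apply, Pi.single_apply]
    simp only [eq_comm (a := j), map_mul, map_add, eval_C, eval_X, apply_ite (eval x), map_one,
      map_zero, Pi.zero_apply]
    split_ifs <;> ring
  le_c h := absurd rfl h
  le_l _ h := absurd rfl h
  le_s j m h := by
    simp only [Matrix.add_apply, Matrix.single_apply] at h ⊢
    split_ifs at h ⊢ <;> first | linarith | simp at h
  ne_zero_of_mem_vars j h := by
    rw [vars_C_mul _ ha0.ne'] at h
    have h1 := vars_mul _ _ h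
    rw [vars_X, vars_X, Finset.mem_union, Finset.mem_singleton, Finset.mem_singleton] at h1
    right
    rcases h1 with rfl | rfl
    · refine ⟨k, ne_of_gt ?_⟩
      simp only [Matrix.add_apply, Matrix.single_apply, and_self, if_true]
      split_ifs <;> linarith
    · refine ⟨i, ne_of_gt ?_⟩
      simp only [Matrix.add_apply, Matrix.single_apply, and_self, if_true]
      split_ifs <;> linarith

/-- A monomial of degree at most `2` is constant, a variable or a product of two variables. -/
theorem exists_isQuadForm_monomial {σ : Type*} [Fintype σ] {μ a : ℝ} (ha0 : 0 < a) (ha : μ ≤ a)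
    (m : σ →₀ ℕ) (hm : (m.sum fun _ e => e) ≤ 2) :
    ∃ c l s, IsQuadForm μ (monomial m a) c l s := by
  classical
  have hcard : Multiset.card (Finsupp.toMultiset m) ≤ 2 := by
    rwa [Finsupp.card_toMultiset]
  have hm' : m = Multiset.toFinsupp (Finsupp.toMultiset m) := (Finsupp.toMultiset_toFinsupp m).symm
  interval_cases hc : Multiset.card (Finsupp.toMultiset m)
  · rw [Multiset.card_eq_zero] at hc
    rw [hc, map_zero] at hm'
    subst hm'
    exact ⟨_, _, _, isQuadForm_C ha0.le ha⟩
  · obtain ⟨i, hi⟩ := Multiset.card_eq_one.1 hc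
    rw [hi, Multiset.toFinsupp_singleton] at hm'
    subst hm'
    rw [← mul_one a, ← C_mul_monomial]
    exact ⟨_, _, _, isQuadForm_C_mul_X ha0 ha i⟩
  · obtain ⟨i, k, hi⟩ := Multiset.card_eq_two.1 hc
    rw [hi, Multiset.insert_eq_cons, ← Multiset.singleton_add, Multiset.toFinsupp_add, Multiset.toFinsupp_singleton,
      Multiset.toFinsupp_singleton] at hm'
    subst hm'
    have : monomial (Finsupp.single i 1 + Finsupp.single k 1) a
        = (C a * (X i * X k) : MvPolynomial σ ℝ) := by
      rw [X, X, monomial_mul, C_mul_monomial]; simp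
    rw [this]
    exact ⟨_, _, _, isQuadForm_C_mul_X_mul_X ha0 ha i k⟩

theorem exists_isQuadForm {σ : Type*} [Fintype σ] {μ : ℝ} (p : MvPolynomial σ ℝ)
    (h0 : ∀ m, 0 ≤ p.coeff m) (hμ : ∀ m, p.coeff m ≠ 0 → μ ≤ p.coeff m)
    (hdeg : p.totalDegree ≤ 2) : ∃ c l s, IsQuadForm μ p c l s := by
  rw [← support_sum_monomial_coeff p]
  refine Finset.sum_induction _ (fun p => ∃ c l s, IsQuadForm μ p c l s)
    (fun p p' ⟨_, _, _, h⟩ ⟨_, _, _, h'⟩ => ⟨_, _, _, h.add h'⟩)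
    ⟨_, _, _, IsQuadForm.zero μ⟩ fun m hm => ?_
  have hne := mem_support_iff.1 hm
  exact exists_isQuadForm_monomial (lt_of_le_of_ne (h0 m) (Ne.symm hne)) (hμ m hne) m
    ((le_totalDegree hm).trans hdeg)

/-- The quadratic system `R` has the same right-hand sides as the polynomials `P`; see `IsQuadForm`
for the role of `μ`. -/
structure Represents {σ : Type*} [Fintype σ] (R : QuadSystem σ) (μ : ℝ)
    (P : σ → MvPolynomial σ ℝ) : Prop where
  eval_eq : ∀ x i, eval x (P i) = R.map x i
  eval_pderiv : ∀ x i j, eval x (pderiv j (P i)) = R.jac x i j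
  le_b : ∀ i, R.b i ≠ 0 → μ ≤ R.b i
  le_L : ∀ i j, R.L i j ≠ 0 → μ ≤ R.L i j
  le_s : ∀ i j k, R.s i j k ≠ 0 → μ ≤ 2 * R.s i j k
  ne_zero_of_mem_vars : ∀ i, ∀ j ∈ (P i).vars, R.L i j ≠ 0 ∨ ∃ k, R.s i j k ≠ 0

theorem exists_represents {σ : Type*} [Fintype σ] {P : σ → MvPolynomial σ ℝ} (hP : IsMPS P)
    (hquad : IsQuadratic P) {μ : ℝ} (hμ : ∀ i m, (P i).coeff m ≠ 0 → μ ≤ (P i).coeff m) :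
    ∃ R, Represents R μ P := by
  choose c l s h using fun i => exists_isQuadForm (P i) (hP i) (hμ i) (hquad i)
  exact ⟨⟨c, l, s, fun i => (h i).c_nonneg, fun i => (h i).l_nonneg, fun i => (h i).s_nonneg,
    fun i => (h i).s_symm⟩, fun x i => (h i).eval_eq x, fun x i => (h i).eval_pderiv x,
    fun i => (h i).le_c, fun i => (h i).le_l, fun i => (h i).le_s,
    fun i => (h i).ne_zero_of_mem_vars⟩

/-! ### Restricting a system to some of its variables -/

open Classical in
/-- The vector that agrees with `x` on `S` and with `y` outside `S`. -/
noncomputable def glue {σ : Type*} {S : Set σ} (x : S → ℝ) (y : σ → ℝ) (j : σ) : ℝ :=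
  if hj : j ∈ S then x ⟨j, hj⟩ else y j

theorem glue_of_mem {σ : Type*} {S : Set σ} (x : S → ℝ) (y : σ → ℝ) (j : S) :
    glue x y j = x j := by simp [glue]

theorem glue_of_notMem {σ : Type*} {S : Set σ} (x : S → ℝ) (y : σ → ℝ) {j : σ} (hj : j ∉ S) :
    glue x y j = y j := by simp [glue, hj]

theorem glue_self {σ : Type*} {S : Set σ} (y : σ → ℝ) : glue (fun j : S => y j) y = y := by
  funext j; simp [glue]

theorem glue_le_glue {σ : Type*} {S : Set σ} {x x' : S → ℝ} {y y' : σ → ℝ} (hx : ∀ j, x j ≤ x' j)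
    (hy : ∀ j, y j ≤ y' j) (j : σ) : glue x y j ≤ glue x' y' j := by
  unfold glue; split_ifs with h
  exacts [hx _, hy _]

theorem glue_nonneg {σ : Type*} {S : Set σ} {x : S → ℝ} {y : σ → ℝ} (hx : ∀ j, 0 ≤ x j)
    (hy : ∀ j, 0 ≤ y j) (j : σ) : 0 ≤ glue x y j := by
  unfold glue; split_ifs with h
  exacts [hx _, hy _]

theorem eval_subsystem {σ : Type*} (P : σ → MvPolynomial σ ℝ) (S : Set σ) (x : S → ℝ) (y : σ → ℝ)
    (i : S) : eval x (subsystem P S y i) = eval (glue x y) (P i) := by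
  unfold subsystem
  induction P i using MvPolynomial.induction_on with
  | C a => simp [algebraMap_eq]
  | add p q hp hq => simp only [map_add, hp, hq]
  | mul_X p j hp =>
    simp only [map_mul, hp, aeval_X, eval_X, glue]
    split_ifs <;> simp

theorem pderiv_subsystem {σ : Type*} (P : σ → MvPolynomial σ ℝ) (S : Set σ) (y : σ → ℝ) (i j : S) :
    pderiv j (subsystem P S y i) = subsystem (fun i => pderiv (j : σ) (P i)) S y i := by
  classical
  unfold subsystem
  beta_reduce
  induction P i using MvPolynomial.induction_on with
  | C a => simp [algebraMap_eq]
  | add p q hp hq => simp only [map_add, hp, hq]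
  | mul_X p k hp =>
    simp only [map_mul, pderiv_mul, map_add, hp, aeval_X, pderiv_X]
    congr 2
    by_cases hk : k ∈ S
    · by_cases hkj : k = j
      · subst hkj; simp
      · have : (⟨k, hk⟩ : S) ≠ j := fun h => hkj (congrArg Subtype.val h)
        simp [hk, pderiv_X, hkj, this]
    · have : k ≠ (j : σ) := fun h => hk (h ▸ j.2)
      simp [hk, this]

theorem subsystem_congr {σ : Type*} {P : σ → MvPolynomial σ ℝ} {S : Set σ} {y y' : σ → ℝ}
    (h : ∀ i ∈ S, ∀ j ∈ (P i).vars, j ∉ S → y j = y' j) : subsystem P S y = subsystem P S y' := by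
  funext i
  unfold subsystem
  refine eval₂Hom_congr' rfl (fun j hj _ => ?_) rfl
  split_ifs with hjS
  · rfl
  · rw [h i i.2 j hj hjS]

/-- The quadratic system in the variables `S` that arises from `R` when the variables outside `S`
are replaced by their values under `y`. Its coefficients are given by the Taylor expansion of `R`
at the point that agrees with `y` outside `S` and vanishes on `S`. -/
noncomputable def QuadSystem.restrict {σ : Type*} [Fintype σ] (R : QuadSystem σ) (S : Set σ)
    (y : σ → ℝ) (hy : ∀ j, 0 ≤ y j) : QuadSystem S where
  b i := R.map (glue (0 : S → ℝ) y) i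
  L := Matrix.of fun i j => R.jac (glue (0 : S → ℝ) y) i j
  s i := Matrix.of fun j k => R.s i j k
  b_nonneg _ := (R.map_zero_nonneg _).trans
    (R.map_mono (fun _ => le_rfl) (glue_nonneg (fun _ => le_rfl) hy) _)
  L_nonneg _ _ := R.jac_nonneg (glue_nonneg (fun _ => le_rfl) hy) _ _
  s_nonneg _ _ _ := R.s_nonneg _ _ _
  s_symm _ _ _ := R.s_symm _ _ _

theorem sum_glue {σ : Type*} [Fintype σ] {S : Set σ} [Fintype S] (f : σ → ℝ) (x : S → ℝ) :
    ∑ j, f j * glue x 0 j = ∑ j : S, f j * x j := by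
  classical
  rw [← Fintype.sum_subtype_add_sum_subtype (· ∈ S),
    Finset.sum_eq_zero (s := (Finset.univ : Finset {j // j ∉ S})) fun j _ => by
      rw [glue_of_notMem x 0 j.2, Pi.zero_apply, mul_zero], add_zero]
  exact Finset.sum_congr (by ext; simp) fun j _ => by rw [glue_of_mem x 0 j]

theorem glue_sub_glue_zero {σ : Type*} {S : Set σ} (x : S → ℝ) (y : σ → ℝ) :
    glue x y - glue (0 : S → ℝ) y = glue x 0 := by
  funext j
  by_cases hj : j ∈ S <;> simp [glue, hj]

theorem QuadSystem.restrict_map {σ : Type*} [Fintype σ] (R : QuadSystem σ) (S : Set σ) [Fintype S]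
    (y : σ → ℝ) (hy : ∀ j, 0 ≤ y j) (x : S → ℝ) (i : S) :
    (R.restrict S y hy).map x i = R.map (glue x y) i := by
  rw [R.map_eq_taylor (glue x y) (glue (0 : S → ℝ) y), glue_sub_glue_zero]
  simp only [Matrix.mulVec, dotProduct, sum_glue]
  simp only [QuadSystem.map, Matrix.mulVec, dotProduct, QuadSystem.restrict, Matrix.of_apply]
  simp only [mul_comm (glue x 0 _), sum_glue]
  simp only [mul_comm (x _)]

theorem QuadSystem.restrict_jac {σ : Type*} [Fintype σ] (R : QuadSystem σ) (S : Set σ) [Fintype S]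
    (y : σ → ℝ) (hy : ∀ j, 0 ≤ y j) (x : S → ℝ) (i j : S) :
    (R.restrict S y hy).jac x i j = R.jac (glue x y) i j := by
  have h : glue x y = glue (0 : S → ℝ) y + glue x 0 := by
    rw [← glue_sub_glue_zero x y]; abel
  rw [h]
  simp only [QuadSystem.jac, QuadSystem.restrict, Matrix.of_apply, Matrix.mulVec_add, Pi.add_apply]
  have : (R.s i).mulVec (glue x 0) j = ∑ k : S, R.s i j k * x k := sum_glue _ _
  rw [this]
  simp only [Matrix.mulVec, dotProduct, Matrix.of_apply]
  ring

/-! ### The constants of a system with positive least fixed point -/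

theorem coeffMin_le {σ : Type*} {P : σ → MvPolynomial σ ℝ} (hP : IsMPS P) {i : σ} {m : σ →₀ ℕ}
    (h : (P i).coeff m ≠ 0) : coeffMin P ≤ (P i).coeff m :=
  csInf_le ⟨0, by rintro _ ⟨-, i, m, rfl⟩; exact hP i m⟩ ⟨h, i, m, rfl⟩

theorem coeffMin_pos {σ : Type*} [Finite σ] {P : σ → MvPolynomial σ ℝ} (hP : IsMPS P) {q : σ → ℝ}
    {i : σ} (hi : 0 < eval q (P i)) : 0 < coeffMin P := by
  have hfin : {c : ℝ | c ≠ 0 ∧ ∃ i m, (P i).coeff m = c}.Finite := by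
    refine (Set.finite_iUnion fun i => ((P i).support.finite_toSet.image (P i).coeff)).subset ?_
    rintro _ ⟨hc, i, m, rfl⟩
    exact Set.mem_iUnion.2 ⟨i, m, mem_support_iff.2 hc, rfl⟩
  have hne : {c : ℝ | c ≠ 0 ∧ ∃ i m, (P i).coeff m = c}.Nonempty := by
    obtain ⟨m, hm⟩ := (ne_zero_iff (p := P i)).1 (fun h => by simp [h] at hi)
    exact ⟨_, hm, i, m, rfl⟩
  obtain ⟨hc, i, m, him⟩ := hne.csInf_mem hfin
  exact lt_of_le_of_ne (by rw [coeffMin, ← him]; exact hP i m) (Ne.symm hc)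

theorem iInf_pos_of_finite {σ : Type*} [Finite σ] [Nonempty σ] {q : σ → ℝ} (hq : ∀ i, 0 < q i) :
    0 < ⨅ i, q i := by
  obtain ⟨i, hi⟩ := exists_eq_ciInf_of_finite (f := q)
  exact hi ▸ hq i

theorem alphaConst_pos {σ : Type*} [Finite σ] [Nonempty σ] {P : σ → MvPolynomial σ ℝ} {q : σ → ℝ}
    (hμ : 0 < coeffMin P) (hq : ∀ i, 0 < q i) : 0 < alphaConst P q :=
  mul_pos (lt_min one_pos hμ) (mul_pos one_half_pos (iInf_pos_of_finite hq))

theorem two_mul_alphaConst_le {σ : Type*} [Finite σ] [Nonempty σ] {P : σ → MvPolynomial σ ℝ}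
    {q : σ → ℝ} (hμ : 0 < coeffMin P) (hq : ∀ i, 0 < q i) (i : σ) :
    2 * alphaConst P q ≤ q i ∧ 2 * alphaConst P q ≤ coeffMin P * q i := by
  have h1 : ⨅ i, q i ≤ q i := ciInf_le (Set.finite_range q).bddBelow i
  have h2 := iInf_pos_of_finite hq
  have h3 : 2 * alphaConst P q = min 1 (coeffMin P) * ⨅ i, q i := by unfold alphaConst; ring
  rw [h3]
  constructor
  · calc min 1 (coeffMin P) * ⨅ i, q i ≤ 1 * ⨅ i, q i := by gcongr; exact min_le_left _ _
      _ ≤ q i := by rw [one_mul]; exact h1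
  · exact mul_le_mul (min_le_right _ _) h1 h2.le hμ.le

/-! ### Newton's method on one strongly connected component -/

theorem newton_subsystem {σ : Type*} [Fintype σ] {P : σ → MvPolynomial σ ℝ} {R : QuadSystem σ}
    {μ : ℝ} (hR : Represents R μ P) (S : Set σ) [Fintype S] [DecidableEq S] {y : σ → ℝ}
    (hy : ∀ j, 0 ≤ y j) (x : S → ℝ) :
    jacobian (subsystem P S y) x = (R.restrict S y hy).jac x ∧
      newton (subsystem P S y) x = (R.restrict S y hy).newton x := by
  have h1 : jacobian (subsystem P S y) x = (R.restrict S y hy).jac x := by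
    ext i j
    rw [jacobian, Matrix.of_apply, pderiv_subsystem,
      eval_subsystem (fun i => pderiv (j : σ) (P i)), hR.eval_pderiv, R.restrict_jac]
  refine ⟨h1, ?_⟩
  unfold newton QuadSystem.newton
  simp only [h1, eval_subsystem, hR.eval_eq, R.restrict_map]

theorem isLinearSCC_iff {σ : Type*} [Fintype σ] {P : σ → MvPolynomial σ ℝ} {R : QuadSystem σ}
    {μ : ℝ} (hR : Represents R μ P) {S : Set σ} {q : σ → ℝ} (hq : ∀ j, 0 ≤ q j) :
    IsLinearSCC P q S ↔ ∀ i j k : S, R.s i j k = 0 := by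
  classical
  let T := R.restrict S q hq
  have hTs : ∀ i j k : S, T.s i j k = R.s i j k := fun _ _ _ => rfl
  constructor
  · intro h i j k
    -- the partial derivatives of a polynomial of degree at most `1` are constant
    have hdeg : (pderiv j (subsystem P S q i)).totalDegree = 0 := by
      refine Nat.le_zero.1 (Finset.sup_le fun m hm => ?_)
      rw [mem_support_iff, coeff_pderiv] at hm
      have h1 := (le_totalDegree (mem_support_iff.2 (left_ne_zero_of_mul hm))).trans (h i)
      rw [Finsupp.sum_add_index' (fun _ => rfl) (fun _ _ _ => rfl),
        Finsupp.sum_single_index rfl] at h1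
      omega
    have hconst : ∀ x : S → ℝ, T.jac x i j = coeff 0 (pderiv j (subsystem P S q i)) := fun x => by
      have h1 := (newton_subsystem hR S hq x).1
      rw [← h1, jacobian, Matrix.of_apply]
      conv_lhs => rw [totalDegree_eq_zero_iff_eq_C.1 hdeg]
      rw [eval_C]
    have h1 := (hconst 1).trans (hconst 0).symm
    simp only [QuadSystem.jac, Matrix.of_apply, Matrix.mulVec_zero, Pi.zero_apply] at h1
    have h2 : ∑ k, T.s i j k * 1 = 0 := by
      change T.L i j + 2 * ∑ k, T.s i j k * 1 = _ at h1
      linarith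
    have h3 := (Finset.sum_eq_zero_iff_of_nonneg fun k _ =>
      mul_nonneg (T.s_nonneg i j k) zero_le_one).1 h2 k (Finset.mem_univ k)
    rwa [mul_one] at h3
  · intro h i
    have hp : subsystem P S q i = C (T.b i) + ∑ j, C (T.L i j) * X j := by
      refine MvPolynomial.funext fun x => ?_
      rw [eval_subsystem, hR.eval_eq, ← R.restrict_map S q hq]
      have : T.s i = 0 := Matrix.ext fun j k => h i j k
      change T.b i + T.L.mulVec x i + x ⬝ᵥ (T.s i).mulVec x = _
      rw [this]
      simp [Matrix.mulVec, dotProduct]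
    rw [hp]
    refine (totalDegree_add _ _).trans (max_le (by simp) (totalDegree_finsetSum_le fun j _ => ?_))
    exact (totalDegree_mul _ _).trans (by simp)

theorem IsSCC.strongConn {σ : Type*} {P : σ → MvPolynomial σ ℝ} {S : Set σ} (hS : IsSCC P S)
    (i j : S) : Relation.ReflTransGen (fun i j : S => DepEdge P i j) i j := by
  obtain ⟨m, rfl⟩ := hS
  have key : ∀ i j : σ, Reaches P i j → ∀ (hi : Reaches P m i ∧ Reaches P i m)
      (hj : Reaches P m j ∧ Reaches P j m),
      Relation.ReflTransGen (fun i j : {j | Reaches P m j ∧ Reaches P j m} => DepEdge P i j)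
        ⟨i, hi⟩ ⟨j, hj⟩ := by
    intro i j hij hi hj
    induction hij with
    | refl => exact .refl
    | tail hik hkj ih =>
      have hk := hi.1.trans hik
      exact (ih ⟨hk, (Relation.ReflTransGen.single hkj).trans hj.2⟩).tail hkj
  obtain ⟨i, hi⟩ := i
  obtain ⟨j, hj⟩ := j
  exact key i j (hi.2.trans hj.1) hi hj

/-- The restriction of the least fixed point to `S` is the least fixed point of the subsystem on
`S`: a smaller one would give a point `z` with `P(z) ≤ z` below `q`. -/
theorem eq_of_restrict_map_eq {σ : Type*} [Fintype σ] {P : σ → MvPolynomial σ ℝ}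
    {R : QuadSystem σ} {μ : ℝ} (hR : Represents R μ P) {q : σ → ℝ} (hq : IsLFP P q) {S : Set σ}
    [Fintype S] {a : S → ℝ} (ha0 : 0 ≤ a) (haq : ∀ j, a j ≤ q j)
    (ha : (R.restrict S q hq.1.1).map a = a) : a = fun j : S => q j := by
  have hq0 : ∀ j, 0 ≤ q j := hq.1.1
  have hz0 : ∀ j, 0 ≤ glue a q j := glue_nonneg ha0 hq0
  have hzq : ∀ j, glue a q j ≤ q j := fun j => by
    have := glue_le_glue haq (fun j => le_refl (q j)) j
    rwa [glue_self] at this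
  have hzz : R.map (glue a q) ≤ glue a q := fun i => by
    by_cases hi : i ∈ S
    · rw [glue_of_mem a q ⟨i, hi⟩, ← R.restrict_map S q hq0 a ⟨i, hi⟩, ha]
    · rw [glue_of_notMem a q hi]
      refine (R.map_mono hz0 hzq i).trans_eq ?_
      rw [← hR.eval_eq]; exact hq.1.2 i
  obtain ⟨p, hp0, hpz, hp⟩ := exists_fixedPoint_of_monotoneOn hz0
    (fun x y hx hxy => R.map_mono hx hxy) R.map_zero_nonneg hzz
  have hqp : q ≤ p := hq.2 ⟨hp0, fun i => by rw [hR.eval_eq, hp]⟩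
  funext j
  refine le_antisymm (haq j) (((hqp j).trans (hpz j)).trans_eq (glue_of_mem a q j))

theorem QuadSystem.map_sub_map_le {σ : Type*} [Fintype σ] (R : QuadSystem σ) {q z : σ → ℝ}
    (hz0 : ∀ j, 0 ≤ z j) (hzq : ∀ j, z j ≤ q j) (hq1 : ∀ j, q j ≤ 1) {δ : ℝ}
    (hδ : ∀ j, q j - z j ≤ δ) (hδ0 : 0 ≤ δ) (i : σ) :
    R.map q i - R.map z i ≤ 2 * R.map 1 i * δ := by
  have h1 : R.map q i - R.map z i
      = R.L.mulVec (q - z) i + (q - z) ⬝ᵥ (R.s i).mulVec (q + z) := by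
    simp only [QuadSystem.map, Matrix.mulVec_sub, Matrix.mulVec_add, sub_dotProduct,
      dotProduct_add, Pi.sub_apply]
    rw [R.bil_comm i z q]; ring
  have h2 : R.L.mulVec (q - z) i ≤ δ * R.L.mulVec 1 i := by
    rw [← smul_eq_mul, ← Pi.smul_apply, ← Matrix.mulVec_smul]
    exact Finset.sum_le_sum fun j _ => mul_le_mul_of_nonneg_left
      (by simpa using hδ j) (R.L_nonneg i j)
  have h3 : (q - z) ⬝ᵥ (R.s i).mulVec (q + z) ≤ 2 * δ * ((1 : σ → ℝ) ⬝ᵥ (R.s i).mulVec 1) := by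
    have h4 : (q - z) ⬝ᵥ (R.s i).mulVec (q + z) ≤ (δ • (1 : σ → ℝ)) ⬝ᵥ (R.s i).mulVec (q + z) :=
      Finset.sum_le_sum fun j _ => mul_le_mul_of_nonneg_right (by simpa using hδ j)
        (R.s_mulVec_nonneg i (fun k => add_nonneg ((hz0 k).trans (hzq k)) (hz0 k)) j)
    have h5 : (δ • (1 : σ → ℝ)) ⬝ᵥ (R.s i).mulVec (q + z)
        ≤ (δ • (1 : σ → ℝ)) ⬝ᵥ (R.s i).mulVec ((2 : ℝ) • 1) :=
      Finset.sum_le_sum fun j _ => mul_le_mul_of_nonneg_left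
        (R.s_mulVec_mono i (fun k => by
          simp only [Pi.add_apply, Pi.smul_apply, Pi.one_apply, smul_eq_mul]
          linarith [hzq k, hq1 k]) j) (by simpa using hδ0)
    refine (h4.trans h5).trans_eq ?_
    rw [Matrix.mulVec_smul, smul_dotProduct, dotProduct_smul, smul_eq_mul, smul_eq_mul]; ring
  have h6 : R.map 1 i = R.b i + R.L.mulVec 1 i + (1 : σ → ℝ) ⬝ᵥ (R.s i).mulVec 1 := rfl
  have h7 : 0 ≤ R.L.mulVec 1 i :=
    Finset.sum_nonneg fun j _ => mul_nonneg (R.L_nonneg i j) zero_le_one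
  rw [h1, h6]
  nlinarith [R.b_nonneg i, mul_nonneg hδ0 h7, mul_nonneg hδ0 (R.b_nonneg i)]

/-- Newton's method with rounding on one strongly connected component `S`, when the values `y`
inserted for the other variables are at most `δ` below those of the least fixed point `q`. -/
theorem scc_newton_error_of_forall {σ : Type*} [Fintype σ] {P : σ → MvPolynomial σ ℝ}
    {q : σ → ℝ} (hP : IsMPS P) (hquad : IsQuadratic P) (hq : IsLFP P q) (hq_pos : ∀ i, 0 < q i)
    (hq_one : ∀ i, q i ≤ 1) {K : ℝ} (hK : ∀ i, eval 1 (P i) ≤ K) {S : Set σ} (hS : IsSCC P S)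
    [Fintype S] [DecidableEq S] {y : σ → ℝ} (hy0 : ∀ j, 0 ≤ y j) (hyq : ∀ j, y j ≤ q j) {δ : ℝ}
    (hδ0 : 0 ≤ δ) (hδ : ∀ j, q j - y j ≤ δ) {h g : ℕ} (hg : h ≤ g + 1) :
    RNMDefined (subsystem P S y) h (sccIterations P q g S) ∧
    (∀ i : S, 0 ≤ rnm (subsystem P S y) h (sccIterations P q g S) i ∧
      rnm (subsystem P S y) h (sccIterations P q g S) i ≤ q i) ∧
    (IsLinearSCC P q S → ∀ i : S, alphaConst P q ^ (Fintype.card S + 2) *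
      (q i - rnm (subsystem P S y) h (sccIterations P q g S) i - (2 ^ h)⁻¹)
        ≤ Fintype.card S * (2 * K * δ)) ∧
    (¬ IsLinearSCC P q S → ∃ ρ,
      alphaConst P q ^ (3 * Fintype.card S + 1) * ρ ^ 2 ≤ Fintype.card S * (2 * K * δ) ∧
      ∀ i : S, alphaConst P q ^ Fintype.card S *
        (q i - rnm (subsystem P S y) h (sccIterations P q g S) i - ρ) ≤ 4 * (2 ^ h)⁻¹) := by
  have hSne : S.Nonempty := by
    obtain ⟨i, rfl⟩ := hS; exact ⟨i, .refl, .refl⟩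
  have : Nonempty S := hSne.to_subtype
  obtain ⟨i₀, -⟩ := id hSne
  have : Nonempty σ := ⟨i₀⟩
  have hq0 : ∀ j, 0 ≤ q j := fun j => (hq_pos j).le
  have hμ : 0 < coeffMin P :=
    coeffMin_pos hP (q := q) (i := i₀) ((hq_pos i₀).trans_eq (hq.1.2 i₀).symm)
  obtain ⟨R, hR⟩ := exists_represents hP hquad fun i m => coeffMin_le hP
  have hE := hS.strongConn
  have hRfix : R.map q = q := funext fun i => by rw [← hR.eval_eq]; exact hq.1.2 i
  set a := alphaConst P q
  have ha0 : 0 < a := alphaConst_pos hμ hq_pos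
  have haq := two_mul_alphaConst_le (P := P) hμ hq_pos
  have ha1 : a ≤ 1 := by linarith [(haq i₀).1, hq_one i₀]
  have haμ : 2 * a ≤ coeffMin P := (haq i₀).2.trans (mul_le_of_le_one_right hμ.le (hq_one i₀))
  set T := R.restrict S q hq0 with hT
  set Q := R.restrict S y hy0 with hQ
  have hjac := fun x => (newton_subsystem hR S hy0 x).1
  have hnewton := fun x => (newton_subsystem hR S hy0 x).2
  have hglue : ∀ j, glue (0 : S → ℝ) y j ≤ glue (0 : S → ℝ) q j :=
    glue_le_glue (fun _ => le_rfl) hyq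
  have hglue0 : ∀ j, 0 ≤ glue (0 : S → ℝ) y j := glue_nonneg (fun _ => le_rfl) hy0
  have hglueq0 : ∀ j, 0 ≤ glue (0 : S → ℝ) q j := glue_nonneg (fun _ => le_rfl) hq0
  have hs : Q.s = T.s := rfl
  have hb : ∀ i, Q.b i ≤ T.b i := fun i => R.map_mono hglue0 hglue i
  have hL : ∀ i j, Q.L i j ≤ T.L i j := fun i j =>
    QuadSystem.jac_le_jac_of_le rfl (fun _ _ => le_rfl) hglue i j
  have hTL : ∀ i j : S, T.L i j = R.L i j + 2 * (R.s i).mulVec (glue (0 : S → ℝ) q) j :=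
    fun _ _ => rfl
  have hQL : ∀ i j : S, Q.L i j = R.L i j + 2 * (R.s i).mulVec (glue (0 : S → ℝ) y) j :=
    fun _ _ => rfl
  have hfix : T.map (fun j : S => q j) = fun j : S => q j := funext fun i => by
    rw [R.restrict_map, glue_self, hRfix]
  have hmin : ∀ p : S → ℝ, 0 ≤ p → p ≤ (fun j : S => q j) → T.map p = p → p = fun j : S => q j :=
    fun p hp0 hpq hp => eq_of_restrict_map_eq hR hq hp0 hpq hp
  have hQq : ∀ i : S, Q.map (fun j : S => q j) i = R.map (glue (fun j : S => q j) y) i :=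
    fun i => R.restrict_map S y hy0 _ i
  have hzq : ∀ j, glue (fun j : S => q j) y j ≤ q j := fun j => by
    have := glue_le_glue (fun j : S => le_refl (q j)) hyq j
    rwa [glue_self] at this
  have hz0 : ∀ j, 0 ≤ glue (fun j : S => q j) y j := glue_nonneg (fun j => hq0 j) hy0
  have hη : ∀ i : S, q i - Q.map (fun j : S => q j) i ≤ 2 * K * δ := fun i => by
    rw [hQq]
    have h1 := R.map_sub_map_le hz0 hzq hq_one (δ := δ)
      (fun j => by
        by_cases hj : j ∈ S
        · rw [glue_of_mem _ y ⟨j, hj⟩, sub_self]; exact hδ0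
        · rw [glue_of_notMem _ y hj]; exact hδ j) hδ0 i
    rw [hRfix, ← hR.eval_eq 1] at h1
    refine h1.trans ?_
    have := hK i
    gcongr
  have single_le : ∀ (i j k : σ) (x : σ → ℝ), (∀ j, 0 ≤ x j) →
      R.s i j k * x k ≤ (R.s i).mulVec x j := fun i j k x hx =>
    Finset.single_le_sum (f := fun k => R.s i j k * x k)
      (fun k _ => mul_nonneg (R.s_nonneg i j k) (hx k)) (Finset.mem_univ k)
  have hG : ∀ i j : S, DepEdge P i j →
      a ≤ T.L i j + (T.s i).mulVec (fun j : S => q j) j := fun i j hij => by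
    have h0 := R.s_mulVec_nonneg i hglueq0 j
    have h1 : 0 ≤ (T.s i).mulVec (fun j : S => q j) j := T.s_mulVec_nonneg i (fun j => hq0 j) j
    have h2 := R.L_nonneg i j
    rw [hTL]
    rcases hR.ne_zero_of_mem_vars i j hij with hne | ⟨k, hne⟩
    · linarith [hR.le_L i j hne]
    · have h3 : 2 * a ≤ 2 * R.s i j k * q k := (haq k).2.trans
        (mul_le_mul_of_nonneg_right (hR.le_s i j k hne) (hq0 k))
      by_cases hk : k ∈ S
      · have h4 : R.s i j k * q k ≤ (T.s i).mulVec (fun j : S => q j) j :=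
          Finset.single_le_sum (f := fun k : S => T.s i j k * q k)
            (fun k _ => mul_nonneg (T.s_nonneg i j k) (hq0 k)) (Finset.mem_univ (⟨k, hk⟩ : S))
        linarith
      · have h4 := single_le i j k _ hglueq0
        rw [glue_of_notMem _ q hk] at h4
        linarith
  by_cases hlin : IsLinearSCC P q S
  · have hs0 := (isLinearSCC_iff hR hq0).1 hlin
    have hit : sccIterations P q g S = 1 := if_pos hlin
    rw [hit]
    have hTb : ∃ j, a ^ 2 ≤ T.b j := by
      by_contra! hcon
      have hb0 : T.map 0 = 0 := funext fun i => by
        have hbi : T.b i = R.b i + R.L.mulVec (glue (0 : S → ℝ) q) i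
          + glue (0 : S → ℝ) q ⬝ᵥ (R.s i).mulVec (glue (0 : S → ℝ) q) := rfl
        have h1 : 0 ≤ R.L.mulVec (glue (0 : S → ℝ) q) i :=
          Finset.sum_nonneg fun j _ => mul_nonneg (R.L_nonneg i j) (hglueq0 j)
        have h2 := R.bil_nonneg i hglueq0 hglueq0
        have h3 := R.b_nonneg i
        have h4 := hcon i
        have ha2 : a ^ 2 ≤ a := by nlinarith
        have hle : ∀ j, glue (0 : S → ℝ) q j ≠ 0 → glue (0 : S → ℝ) q j = q j := fun j hj => by
          by_cases hjS : j ∈ S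
          · exact absurd (glue_of_mem 0 q ⟨j, hjS⟩) hj
          · exact glue_of_notMem 0 q hjS
        have hRb : R.b i = 0 := by
          by_contra hne
          linarith [hR.le_b i hne]
        have hRL : R.L.mulVec (glue (0 : S → ℝ) q) i = 0 := by
          refine Finset.sum_eq_zero fun j _ => ?_
          by_contra hne
          have h5 := hR.le_L i j (left_ne_zero_of_mul hne)
          have h6 : R.L i j * glue (0 : S → ℝ) q j ≤ R.L.mulVec (glue (0 : S → ℝ) q) i :=
            Finset.single_le_sum (f := fun j => R.L i j * glue (0 : S → ℝ) q j)
              (fun j _ => mul_nonneg (R.L_nonneg i j) (hglueq0 j)) (Finset.mem_univ j)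
          rw [hle j (right_ne_zero_of_mul hne)] at h6
          have h7 := mul_le_mul_of_nonneg_right h5 (hq0 j)
          linarith [(haq j).2]
        have hRs : glue (0 : S → ℝ) q ⬝ᵥ (R.s i).mulVec (glue (0 : S → ℝ) q) = 0 := by
          refine Finset.sum_eq_zero fun j _ => ?_
          rw [Matrix.mulVec, dotProduct, Finset.mul_sum]
          refine Finset.sum_eq_zero fun k _ => ?_
          by_contra hne
          have hj := hle j (left_ne_zero_of_mul hne)
          have hk := hle k (right_ne_zero_of_mul (right_ne_zero_of_mul hne))
          have h5 := hR.le_s i j k (left_ne_zero_of_mul (right_ne_zero_of_mul hne))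
          have h6 := R.mul_le_bil i hglueq0 hglueq0 j k
          rw [hj, hk] at h6
          have h7 : a ≤ R.s i j k * q j := by
            linarith [(haq j).2, mul_le_mul_of_nonneg_right h5 (hq0 j)]
          have h8 : a ≤ q k := by linarith [(haq k).1]
          have h9 : a * a ≤ R.s i j k * q j * q k :=
            mul_le_mul h7 h8 ha0.le (ha0.le.trans h7)
          linarith [mul_assoc (R.s i j k) (q j) (q k), sq a]
        simp only [QuadSystem.map, Matrix.mulVec_zero, dotProduct_zero, Pi.zero_apply, add_zero]
        rw [hbi, hRb, hRL, hRs]; simp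
      have h1 := hmin 0 le_rfl (fun j => hq0 j) hb0
      exact (hq_pos hSne.some).ne (congrFun h1 ⟨hSne.some, hSne.some_mem⟩)
    obtain ⟨hU, hbound⟩ := QuadSystem.linear_newton_error hE hs hb hL (fun j : S => hq_pos j)
      (fun j : S => hq_one j) hfix ha0 ha1 hG hs0 (pow_pos ha0 2) hTb hη h
    have hrnm : ∀ i, rnm (subsystem P S y) h 1 i = roundDown h (Q.newton 0 i) := fun i => by
      rw [← hnewton]; rfl
    refine ⟨fun l hl => ?_, fun i => ?_, fun _ i => ?_, fun hn => absurd hlin hn⟩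
    · obtain rfl : l = 0 := by omega
      rw [hjac]; exact hU
    · rw [hrnm]; exact ⟨roundDown_nonneg _ _, (hbound i).1⟩
    · rw [hrnm, pow_add]; exact (hbound i).2
  · have hit : sccIterations P q g S = g := if_neg hlin
    rw [hit]
    have hnl : ∃ i j k : S, a ≤ T.s i j k := by
      by_contra! hcon
      refine hlin ((isLinearSCC_iff hR hq0).2 fun i j k => ?_)
      by_contra hne
      have h1 := hR.le_s i j k hne
      have h2 : R.s i j k < a := hcon i j k
      linarith
    have hpos : ∀ i j : S, DepEdge P i j → 0 < Q.L i j ∨ Q.map (fun j : S => q j) i < q i ∨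
        ∃ k, 0 < Q.s i j k := fun i j hij => by
      have h0 := R.s_mulVec_nonneg i hglue0 j
      rcases hR.ne_zero_of_mem_vars i j hij with hne | ⟨k, hne⟩
      · left; rw [hQL]; linarith [hR.le_L i j hne]
      · have hsp : 0 < R.s i j k := lt_of_le_of_ne (R.s_nonneg i j k) (Ne.symm hne)
        by_cases hk : k ∈ S
        · exact Or.inr (Or.inr ⟨⟨k, hk⟩, hsp⟩)
        · rcases (hy0 k).lt_or_eq with hyk | hyk
          · left
            have h4 := single_le i j k _ hglue0
            rw [glue_of_notMem _ y hk] at h4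
            rw [hQL]; linarith [R.L_nonneg i j, mul_pos hsp hyk]
          · right; left
            -- a positive coefficient `s i j k` gets lost when `q k > 0` is replaced by `y k = 0`
            set z := glue (fun j : S => q j) y with hz
            have hd : ∀ j, 0 ≤ (q - z) j := fun j => sub_nonneg.2 (hzq j)
            have h5 := R.map_eq_taylor q z i
            have h6 : R.s i k j * (q j * (q - z) k) ≤ (R.jac z).mulVec (q - z) i := by
              rw [R.jac_mulVec]
              have h7 : 0 ≤ R.L.mulVec (q - z) i :=
                Finset.sum_nonneg fun j _ => mul_nonneg (R.L_nonneg i j) (hd j)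
              have h8 := R.mul_le_bil i hd hz0 k j
              have h9 := R.bil_nonneg i hd hz0
              have h10 : z j = q j := glue_of_mem _ y j
              rw [h10, mul_comm ((q - z) k)] at h8
              linarith
            have h7 : (q - z) k = q k := by
              rw [Pi.sub_apply, hz, glue_of_notMem _ y hk, ← hyk, sub_zero]
            rw [hRfix] at h5
            have h8 : 0 < R.s i k j * (q j * (q - z) k) := by
              rw [R.s_symm, h7]; exact mul_pos hsp (mul_pos (hq_pos j) (hq_pos k))
            rw [hQq]
            linarith [R.bil_nonneg i hd hd]
    obtain ⟨hU, hbd, ρ, hρ, hbound⟩ := QuadSystem.nonlinear_newton_error hE hs hb hL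
      (fun j : S => hq_pos j) (fun j : S => hq_one j) hfix hmin ha0 ha1 hG hnl hpos hη
      (h := h) (x := rnm (subsystem P S y) h) rfl (fun k i => by rw [← hnewton]; rfl)
    exact ⟨fun l _ => by rw [hjac]; exact hU l, hbd g, fun hl => absurd hl hlin,
      fun _ => ⟨ρ, hρ, hbound g hg⟩⟩

/-! ### Paths in the DAG of strongly connected components -/

/-- The strongly connected component of the variable `i`. -/
def scc {σ : Type*} (P : σ → MvPolynomial σ ℝ) (i : σ) : Set σ :=
  {j | Reaches P i j ∧ Reaches P j i}

theorem mem_scc_self {σ : Type*} (P : σ → MvPolynomial σ ℝ) (i : σ) : i ∈ scc P i :=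
  ⟨.refl, .refl⟩

theorem isSCC_scc {σ : Type*} (P : σ → MvPolynomial σ ℝ) (i : σ) : IsSCC P (scc P i) := ⟨i, rfl⟩

theorem IsSCC.eq_scc {σ : Type*} {P : σ → MvPolynomial σ ℝ} {S : Set σ} (hS : IsSCC P S) {i : σ}
    (hi : i ∈ S) : S = scc P i := by
  obtain ⟨m, rfl⟩ := hS
  ext j
  exact ⟨fun hj => ⟨hi.2.trans hj.1, hj.2.trans hi.1⟩,
    fun hj => ⟨hi.1.trans hj.1, hj.2.trans hi.2⟩⟩

/-- The number of variables reachable from `S`. It decreases along the edges of the DAG of SCCs. -/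
noncomputable def sccRank {σ : Type*} (P : σ → MvPolynomial σ ℝ) (S : Set σ) : ℕ :=
  {k | ∃ i ∈ S, Reaches P i k}.ncard

theorem sccRank_lt_of_dagEdge {σ : Type*} [Finite σ] {P : σ → MvPolynomial σ ℝ} {S T : Set σ}
    (hS : IsSCC P S) (hT : IsSCC P T) (h : DagEdge P S T) : sccRank P T < sccRank P S := by
  obtain ⟨hne, i, hi, j, hj, hij⟩ := h
  have hTj : ∀ t ∈ T, Reaches P j t := fun t ht => by
    rw [hT.eq_scc hj] at ht; exact ht.1
  refine Set.ncard_lt_ncard ⟨?_, fun hsub => ?_⟩ (Set.toFinite _)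
  · rintro k ⟨t, ht, htk⟩
    exact ⟨i, hi, (Relation.ReflTransGen.single hij).trans ((hTj t ht).trans htk)⟩
  · obtain ⟨t, ht, hti⟩ := hsub ⟨i, hi, .refl⟩
    refine hne ?_
    rw [hS.eq_scc hi]
    refine (hT.eq_scc ?_).symm
    rw [hT.eq_scc hj]
    exact ⟨(hTj t ht).trans hti, .single hij⟩

theorem IsDagPath.tail {σ : Type*} {P : σ → MvPolynomial σ ℝ} {S : Set σ} {l : List (Set σ)}
    (h : IsDagPath P (S :: l)) : IsDagPath P l :=
  ⟨fun T hT => h.1 T (List.mem_cons_of_mem S hT), h.2.tail⟩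

/-- The rank decreases along a path, so the components on it are distinct and their number is
bounded. -/
theorem IsDagPath.rank {σ : Type*} [Finite σ] {P : σ → MvPolynomial σ ℝ} {S : Set σ}
    {l : List (Set σ)} (h : IsDagPath P (S :: l)) :
    l.length + 1 ≤ sccRank P S ∧ ∀ T ∈ l, sccRank P T < sccRank P S := by
  induction l generalizing S with
  | nil =>
    obtain ⟨i, hi⟩ := h.1 S (by simp)
    refine ⟨Set.ncard_pos (Set.toFinite _) |>.2 ⟨i, i, ?_, .refl⟩, by simp⟩
    rw [hi]; exact ⟨.refl, .refl⟩
  | cons T l ih =>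
    have h1 := sccRank_lt_of_dagEdge (h.1 S (by simp)) (h.1 T (by simp))
      (List.isChain_cons_cons.1 h.2).1
    obtain ⟨h2, h3⟩ := ih h.tail
    refine ⟨by rw [List.length_cons]; omega, fun U hU => ?_⟩
    rcases List.mem_cons.1 hU with rfl | hU
    · exact h1
    · exact (h3 U hU).trans h1

theorem IsDagPath.length_le_card {σ : Type*} [Finite σ] {P : σ → MvPolynomial σ ℝ}
    {l : List (Set σ)} (h : IsDagPath P l) : l.length ≤ Nat.card σ := by
  cases l with
  | nil => simp
  | cons S l => exact h.rank.1.trans (Set.ncard_le_card _)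

/-- The number of nonlinear components in the list `l`. -/
noncomputable def nonlinearCount {σ : Type*} (P : σ → MvPolynomial σ ℝ) (q : σ → ℝ)
    (l : List (Set σ)) : ℕ :=
  {S | S ∈ l ∧ ¬ IsLinearSCC P q S}.ncard

theorem nonlinearCount_le_length {σ : Type*} (P : σ → MvPolynomial σ ℝ) (q : σ → ℝ)
    (l : List (Set σ)) : nonlinearCount P q l ≤ l.length := by
  classical
  refine (Set.ncard_le_ncard (t := (l.toFinset : Set (Set σ))) (fun S hS => ?_)
    (Finset.finite_toSet _)).trans ?_
  · simpa using hS.1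
  · rw [Set.ncard_coe_finset]; exact List.toFinset_card_le l

theorem nonlinearCount_cons_of_isLinearSCC {σ : Type*} {P : σ → MvPolynomial σ ℝ} {q : σ → ℝ}
    {S : Set σ} (hS : IsLinearSCC P q S) (l : List (Set σ)) :
    nonlinearCount P q (S :: l) = nonlinearCount P q l := by
  unfold nonlinearCount
  congr 1
  ext T
  simp only [List.mem_cons, Set.mem_ofPred_eq]
  constructor
  · rintro ⟨rfl | h, hT⟩
    · exact absurd hS hT
    · exact ⟨h, hT⟩
  · exact fun ⟨h, hT⟩ => ⟨Or.inr h, hT⟩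

theorem nonlinearCount_cons_of_not_isLinearSCC {σ : Type*} [Finite σ] {P : σ → MvPolynomial σ ℝ}
    {q : σ → ℝ} {S : Set σ} (hS : ¬ IsLinearSCC P q S) {l : List (Set σ)}
    (h : IsDagPath P (S :: l)) :
    nonlinearCount P q (S :: l) = nonlinearCount P q l + 1 := by
  have hSl : S ∉ l := fun hmem => lt_irrefl _ (h.rank.2 S hmem)
  unfold nonlinearCount
  rw [← Set.ncard_insert_of_notMem (fun hm => hSl hm.1) (Set.toFinite _)]
  congr 1
  ext T
  simp only [List.mem_cons, Set.mem_ofPred_eq, Set.mem_insert_iff]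
  constructor
  · rintro ⟨rfl | h, hT⟩
    · exact Or.inl rfl
    · exact Or.inr ⟨h, hT⟩
  · rintro (rfl | ⟨h, hT⟩)
    · exact ⟨Or.inl rfl, hS⟩
    · exact ⟨Or.inr h, hT⟩

theorem IsDagPath.length_le_sccDepth {σ : Type*} [Finite σ] {P : σ → MvPolynomial σ ℝ}
    {l : List (Set σ)} (h : IsDagPath P l) : l.length ≤ sccDepth P :=
  le_csSup ⟨Nat.card σ, by rintro _ ⟨l, hl, rfl⟩; exact hl.length_le_card⟩ ⟨l, h, rfl⟩

theorem IsDagPath.nonlinearCount_le {σ : Type*} [Finite σ] {P : σ → MvPolynomial σ ℝ}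
    {q : σ → ℝ} {l : List (Set σ)} (h : IsDagPath P l) :
    nonlinearCount P q l ≤ nonlinearDepth P q :=
  le_csSup ⟨Nat.card σ, by
    rintro _ ⟨l, hl, rfl⟩; exact (nonlinearCount_le_length P q l).trans hl.length_le_card⟩
    ⟨l, h, rfl⟩

/-! ### The recursion along the DAG of components -/

/-- An equation that determines each value from the values at smaller arguments has a unique
solution. -/
theorem existsUnique_of_wellFounded {σ β : Type*} [Inhabited β] {r : σ → σ → Prop}
    (hr : WellFounded r) {Φ : (σ → β) → σ → β}
    (hΦ : ∀ i y y', (∀ j, r j i → y j = y' j) → Φ y i = Φ y' i) : ∃! y, ∀ i, y i = Φ y i := by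
  classical
  let F : ∀ i, (∀ j, r j i → β) → β := fun i y => Φ (fun j => if h : r j i then y j h else default) i
  refine ⟨hr.fix F, fun i => ?_, fun y hy => funext fun i => ?_⟩
  · rw [hr.fix_eq]
    exact hΦ i _ _ fun j hj => by simp [hj]
  · induction i using hr.induction with
    | _ i ih =>
      rw [hy i, hr.fix_eq]
      exact hΦ i _ _ fun j hj => by simp [hj, ih j hj]

/-- The variable `j` lies in a component strictly below that of `i`. -/
def Below {σ : Type*} (P : σ → MvPolynomial σ ℝ) (j i : σ) : Prop :=
  Reaches P i j ∧ ¬ Reaches P j i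

theorem wellFounded_below {σ : Type*} [Finite σ] (P : σ → MvPolynomial σ ℝ) :
    WellFounded (Below P) := by
  have : IsTrans σ (Below P) := ⟨fun _ _ _ hab hbc =>
    ⟨hbc.1.trans hab.1, fun h => hab.2 (h.trans hbc.1)⟩⟩
  have : Std.Irrefl (Below P) := ⟨fun _ h => h.2 .refl⟩
  exact Finite.wellFounded_of_trans_of_irrefl _

theorem below_of_mem_vars {σ : Type*} {P : σ → MvPolynomial σ ℝ} {i k j : σ} (hk : k ∈ scc P i)
    (hj : j ∈ (P k).vars) (hjS : j ∉ scc P i) : Below P j i :=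
  have hij : Reaches P i j := hk.1.tail hj
  ⟨hij, fun hji => hjS ⟨hij, hji⟩⟩

open Classical in
/-- One round of the decomposed method: every component is recomputed from the values `y`. -/
noncomputable def rdnmStep {σ : Type*} [Fintype σ] (P : σ → MvPolynomial σ ℝ) (q : σ → ℝ)
    (h g : ℕ) (y : σ → ℝ) (i : σ) : ℝ :=
  rnm (subsystem P (scc P i) y) h (sccIterations P q g (scc P i)) ⟨i, mem_scc_self P i⟩

theorem existsUnique_rdnmStep_fixed {σ : Type*} [Fintype σ] (P : σ → MvPolynomial σ ℝ) (q : σ → ℝ)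
    (h g : ℕ) : ∃! r : σ → ℝ, ∀ i, r i = rdnmStep P q h g r i := by
  refine existsUnique_of_wellFounded (wellFounded_below P) fun i y y' hyy => ?_
  unfold rdnmStep
  rw [subsystem_congr fun k hk j hj hjS => hyy j (below_of_mem_vars hk hj hjS)]

theorem RDNMReturns.eq_rdnmStep {σ : Type*} [Fintype σ] {P : σ → MvPolynomial σ ℝ} {q : σ → ℝ}
    {h g : ℕ} {r : σ → ℝ} (hr : RDNMReturns P q h g r) (i : σ) : r i = rdnmStep P q h g r i :=
  (hr _ (isSCC_scc P i)).2 ⟨i, mem_scc_self P i⟩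

open Classical in
theorem rdnmReturns_of_eq_rdnmStep {σ : Type*} [Fintype σ] {P : σ → MvPolynomial σ ℝ} {q : σ → ℝ}
    {h g : ℕ} {r : σ → ℝ} (hr : ∀ i, r i = rdnmStep P q h g r i)
    (hdef : ∀ i, RNMDefined (subsystem P (scc P i) r) h (sccIterations P q g (scc P i))) :
    RDNMReturns P q h g r := by
  intro S hS
  refine ⟨?_, fun i => ?_⟩
  · obtain ⟨i, hi⟩ := id hS
    obtain rfl : S = scc P i := hi
    exact hdef i
  · obtain ⟨i, hi⟩ := i
    obtain rfl : S = scc P i := hS.eq_scc hi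
    exact hr i

/-! ### Propagation of the error -/

/-- The error bound of a component with only linear equations, given the bound `Λ ^ m * t` for the
error of the components below it. -/
theorem linear_error_step {a K Λ t δ X η : ℝ} {n N m : ℕ} (ha0 : 0 < a) (ha1 : a ≤ 1)
    (hn : 0 < n) (hN : N ≤ n) (hK : 0 ≤ K) (hΛ : Λ * a ^ (4 * n + 1) = 16 * n * K) (hΛ1 : 1 ≤ Λ)
    (hδ0 : 0 ≤ δ) (hδ : δ ≤ Λ ^ m * t) (ht : 0 < t) (hη : 8 * η ≤ t)
    (hX : a ^ (N + 2) * (X - η) ≤ N * (2 * K * δ)) : X ≤ Λ ^ (m + 1) * t := by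
  have h1 : t ≤ Λ ^ (m + 1) * t := le_mul_of_one_le_left ht.le (one_le_pow₀ hΛ1)
  by_cases hneg : X - η ≤ 0
  · linarith
  push Not at hneg
  have h2 : a ^ (4 * n + 1) * (X - η) ≤ a ^ (4 * n + 1) * (Λ * δ / 8) := by
    calc a ^ (4 * n + 1) * (X - η) ≤ a ^ (N + 2) * (X - η) :=
          mul_le_mul_of_nonneg_right (pow_le_pow_of_le_one ha0.le ha1 (by omega)) hneg.le
      _ ≤ N * (2 * K * δ) := hX
      _ ≤ n * (2 * K * δ) := by gcongr
      _ = 16 * n * K * δ / 8 := by ring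
      _ = a ^ (4 * n + 1) * (Λ * δ / 8) := by rw [← hΛ]; ring
  have h3 := le_of_mul_le_mul_left h2 (pow_pos ha0 _)
  have h4 : Λ * δ ≤ Λ ^ (m + 1) * t := by
    rw [pow_succ', mul_assoc]; gcongr
  linarith

/-- The error bound of a nonlinear component, given the bound `Λ ^ m * t ^ 2` for the error of the
components below it. -/
theorem nonlinear_error_step {a K Λ t δ X η ρ : ℝ} {n N m : ℕ} (ha0 : 0 < a) (ha1 : a ≤ 1)
    (hN : N ≤ n) (hK : 0 ≤ K) (hΛ : Λ * a ^ (4 * n + 1) = 16 * n * K) (hΛ1 : 1 ≤ Λ)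
    (hΛa : 1 ≤ Λ * a ^ (4 * n)) (hδ0 : 0 ≤ δ) (hδ : δ ≤ Λ ^ m * t ^ 2) (ht : 0 < t)
    (hη : 8 * η ≤ t) (hρ : a ^ (3 * N + 1) * ρ ^ 2 ≤ N * (2 * K * δ))
    (hX : a ^ N * (X - ρ) ≤ 4 * η) : X ≤ Λ ^ (m + 1) * t := by
  have hM : 1 ≤ Λ ^ (m + 1) := one_le_pow₀ hΛ1
  have hρ' : ρ ≤ Λ ^ (m + 1) * t / 2 := by
    have h2 : a ^ (4 * n + 1) * ρ ^ 2 ≤ a ^ (4 * n + 1) * (Λ * δ / 8) := by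
      calc a ^ (4 * n + 1) * ρ ^ 2 ≤ a ^ (3 * N + 1) * ρ ^ 2 :=
            mul_le_mul_of_nonneg_right (pow_le_pow_of_le_one ha0.le ha1 (by omega)) (sq_nonneg ρ)
        _ ≤ N * (2 * K * δ) := hρ
        _ ≤ n * (2 * K * δ) := by gcongr
        _ = 16 * n * K * δ / 8 := by ring
        _ = a ^ (4 * n + 1) * (Λ * δ / 8) := by rw [← hΛ]; ring
    have h3 := le_of_mul_le_mul_left h2 (pow_pos ha0 _)
    have h4 : Λ * δ ≤ Λ ^ (m + 1) * t ^ 2 := by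
      rw [pow_succ', mul_assoc]; gcongr
    refine le_of_sq_le_sq ?_ (by positivity)
    nlinarith [mul_le_mul_of_nonneg_right hM (mul_nonneg (zero_le_one.trans hM) (sq_nonneg t)),
      mul_nonneg (zero_le_one.trans hM) (sq_nonneg t)]
  have hX' : X - ρ ≤ Λ ^ (m + 1) * t / 2 := by
    have h1 : 1 ≤ a ^ N * Λ ^ (m + 1) := by
      calc 1 ≤ Λ * a ^ (4 * n) := hΛa
        _ ≤ Λ ^ (m + 1) * a ^ N := by
          gcongr ?_ * ?_
          · exact le_self_pow₀ hΛ1 (by omega)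
          · exact pow_le_pow_of_le_one ha0.le ha1 (by omega)
        _ = _ := mul_comm _ _
    refine le_of_mul_le_mul_left (hX.trans ?_) (pow_pos ha0 N)
    nlinarith
  linarith

/-- The error of the decomposed method at the variable `i` is bounded in terms of the length and
the number of nonlinear components of some path that starts at the component of `i`: the path
continues with the neighbouring component that has the largest error. -/
theorem rdnm_error {σ : Type*} [Fintype σ] {P : σ → MvPolynomial σ ℝ}
    {q : σ → ℝ} (hP : IsMPS P) (hquad : IsQuadratic P) (hq : IsLFP P q) (hq_pos : ∀ i, 0 < q i)
    (hq_one : ∀ i, q i ≤ 1) {K Λ θ : ℝ} (hK : ∀ i, eval 1 (P i) ≤ K) (hK0 : 0 ≤ K)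
    (ha0 : 0 < alphaConst P q) (ha1 : alphaConst P q ≤ 1)
    (hΛ : Λ * alphaConst P q ^ (4 * Fintype.card σ + 1) = 16 * Fintype.card σ * K) (hΛ1 : 1 ≤ Λ)
    (hΛa : 1 ≤ Λ * alphaConst P q ^ (4 * Fintype.card σ)) (hθ0 : 0 < θ) (hθ1 : θ ≤ 1) {h g : ℕ}
    (hh : 8 * (2 ^ h : ℝ)⁻¹ ≤ θ ^ 2 ^ nonlinearDepth P q) (hg : h ≤ g + 1) {r : σ → ℝ}
    (hr : ∀ i, r i = rdnmStep P q h g r i) (i : σ) :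
    (open Classical in
      RNMDefined (subsystem P (scc P i) r) h (sccIterations P q g (scc P i))) ∧
    0 ≤ r i ∧ r i ≤ q i ∧ ∃ l, IsDagPath P (scc P i :: l) ∧
      q i - r i ≤ Λ ^ (l.length + 1) *
        θ ^ 2 ^ (nonlinearDepth P q - nonlinearCount P q (scc P i :: l)) := by
  classical
  induction i using (wellFounded_below P).induction with
  | _ i ih =>
    let S := scc P i
    have hS : IsSCC P S := isSCC_scc P i
    -- the variables outside `S` that occur in the equations of `S`
    let J : Finset σ := Finset.univ.filter fun j => (∃ k ∈ S, j ∈ (P k).vars) ∧ j ∉ S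
    have hJ : ∀ j, j ∈ J ↔ (∃ k ∈ S, j ∈ (P k).vars) ∧ j ∉ S := fun j => by simp [J]
    have hJb : ∀ j ∈ J, Below P j i := fun j hj => by
      obtain ⟨⟨k, hk, hkj⟩, hjS⟩ := (hJ j).1 hj
      exact below_of_mem_vars hk hkj hjS
    let y : σ → ℝ := fun j => if j ∈ J then r j else q j
    have hsub : subsystem P S r = subsystem P S y := subsystem_congr fun k hk j hj hjS => by
      have : j ∈ J := (hJ j).2 ⟨⟨k, hk, hj⟩, hjS⟩
      simp [y, this]
    have hy0 : ∀ j, 0 ≤ y j := fun j => by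
      by_cases hj : j ∈ J
      · simpa [y, hj] using (ih j (hJb j hj)).2.1
      · simpa [y, hj] using (hq_pos j).le
    have hyq : ∀ j, y j ≤ q j := fun j => by
      by_cases hj : j ∈ J
      · simpa [y, hj] using (ih j (hJb j hj)).2.2.1
      · simp [y, hj]
    obtain ⟨l, δ, hl, hδ0, hδ, hyδ⟩ : ∃ l δ, IsDagPath P (S :: l) ∧ 0 ≤ δ ∧
        δ ≤ Λ ^ l.length * θ ^ 2 ^ (nonlinearDepth P q - nonlinearCount P q l) ∧
        ∀ j, q j - y j ≤ δ := by
      rcases J.eq_empty_or_nonempty with hJe | hJne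
      · refine ⟨[], 0, ⟨by simpa using hS, by simp⟩, le_rfl, ?_, fun j => ?_⟩
        · positivity
        · simp [y, hJe]
      · obtain ⟨j, hj, hmax⟩ := J.exists_max_image (fun j => q j - r j) hJne
        obtain ⟨-, -, hrq, l, hl, hle⟩ := ih j (hJb j hj)
        obtain ⟨⟨k, hk, hkj⟩, hjS⟩ := (hJ j).1 hj
        refine ⟨scc P j :: l, q j - r j, ⟨?_, ?_⟩, sub_nonneg.2 hrq, hle, fun m => ?_⟩
        · intro T hT
          rcases List.mem_cons.1 hT with rfl | hT
          exacts [hS, hl.1 T hT]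
        · refine List.isChain_cons_cons.2 ⟨⟨fun heq => hjS ?_, k, hk, j, mem_scc_self P j, hkj⟩,
            hl.2⟩
          rw [heq]; exact mem_scc_self P j
        · by_cases hm : m ∈ J
          · simpa [y, hm] using hmax m hm
          · simpa [y, hm] using hrq
    obtain ⟨hdef, hbd, hlin, hnonlin⟩ := scc_newton_error_of_forall hP hquad hq hq_pos hq_one hK hS
      hy0 hyq hδ0 hyδ hg
    have hri : r i = rnm (subsystem P S y) h (sccIterations P q g S) ⟨i, mem_scc_self P i⟩ := by
      rw [← hsub]; exact hr i
    have hN : Fintype.card S ≤ Fintype.card σ := by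
      simpa only [Nat.card_eq_fintype_card] using Finite.card_subtype_le (· ∈ S)
    have hn : 0 < Fintype.card σ := Fintype.card_pos_iff.2 ⟨i⟩
    have hpow : ∀ k ≤ nonlinearDepth P q, 8 * (2 ^ h : ℝ)⁻¹ ≤ θ ^ 2 ^ k := fun k hk =>
      hh.trans (pow_le_pow_of_le_one hθ0.le hθ1 (Nat.pow_le_pow_right two_pos hk))
    refine ⟨?_, ?_, ?_, l, hl, ?_⟩
    · change RNMDefined (subsystem P S r) h (sccIterations P q g S)
      rw [hsub]; exact hdef
    · rw [hri]; exact (hbd _).1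
    · rw [hri]; exact (hbd _).2
    · by_cases hSlin : IsLinearSCC P q S
      · rw [nonlinearCount_cons_of_isLinearSCC hSlin]
        have h1 := hlin hSlin ⟨i, mem_scc_self P i⟩
        rw [← hri] at h1
        exact linear_error_step ha0 ha1 hn hN hK0 hΛ hΛ1 hδ0 hδ (by positivity)
          (hpow _ (Nat.sub_le _ _)) h1
      · have hle : nonlinearCount P q (S :: l) ≤ nonlinearDepth P q := hl.nonlinearCount_le
        rw [nonlinearCount_cons_of_not_isLinearSCC hSlin hl] at hle ⊢
        obtain ⟨ρ, hρ, h1⟩ := hnonlin hSlin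
        have h2 := h1 ⟨i, mem_scc_self P i⟩
        rw [← hri] at h2
        refine nonlinear_error_step ha0 ha1 hN hK0 hΛ hΛ1 hΛa hδ0 (hδ.trans_eq ?_)
          (by positivity) (hpow _ (Nat.sub_le _ _)) hρ h2
        rw [← pow_mul, ← pow_succ]
        congr 3; omega

/-- The choice of the rounding parameter: `θ = ε / Λ ^ d` satisfies `8 * 2 ^ (-h) ≤ θ ^ (2 ^ f)`. -/
theorem eight_mul_inv_two_pow_le {a K ε : ℝ} {n d f h : ℕ} (ha0 : 0 < a) (hn : 0 < n) (hK : 0 < K)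
    (hε : 0 < ε)
    (hh : ⌈3 + 2 ^ f * (Real.logb 2 (1 / ε) + (d : ℝ) *
      (Real.logb 2 (a ^ (-(4 * (n : ℤ) + 1))) + Real.logb 2 (16 * (n : ℝ)) + Real.logb 2 K))⌉
        ≤ (h : ℤ)) :
    8 * (2 ^ h : ℝ)⁻¹ ≤ (ε / (a ^ (-(4 * (n : ℤ) + 1)) * (16 * n) * K) ^ d) ^ 2 ^ f := by
  have hn' : (0 : ℝ) < n := by exact_mod_cast hn
  have hz : 0 < a ^ (-(4 * (n : ℤ) + 1)) := zpow_pos ha0 _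
  set Λ := a ^ (-(4 * (n : ℤ) + 1)) * (16 * n) * K with hΛ
  have hΛ0 : 0 < Λ := by positivity
  have h1 := Int.ceil_le.1 hh
  rw [← Real.logb_mul hz.ne' (by positivity), ← Real.logb_mul (by positivity) hK.ne', ← hΛ,
    ← Real.logb_pow, ← Real.logb_mul (by positivity) (by positivity),
    show (2 : ℝ) ^ f = ((2 ^ f : ℕ) : ℝ) by push_cast; rfl, ← Real.logb_pow,
    show (3 : ℝ) = Real.logb 2 8 by
      rw [show (8 : ℝ) = 2 ^ (3 : ℕ) by norm_num, Real.logb_pow, Real.logb_self_eq_one one_lt_two]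
      norm_num,
    ← Real.logb_mul (by norm_num) (by positivity),
    Real.logb_le_iff_le_rpow one_lt_two (by positivity)] at h1
  rw [Int.cast_natCast, Real.rpow_natCast] at h1
  rw [show ε / Λ ^ d = (1 / ε * Λ ^ d)⁻¹ by rw [mul_inv, one_div, inv_inv, div_eq_mul_inv], inv_pow,
    ← div_eq_mul_inv, div_le_iff₀ (by positivity), inv_mul_eq_div, le_div_iff₀ (by positivity)]
  exact h1

theorem theorem3 (n : ℕ) (hn : 0 < n) (P : Fin n → MvPolynomial (Fin n) ℝ) (q : Fin n → ℝ)
    (hP : IsMPS P) (hquad : IsQuadratic P) (hq : IsLFP P q)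
    (hq_pos : ∀ i, 0 < q i) (hq_one : ∀ i, q i ≤ 1)
    (ε : ℝ) (hε_pos : 0 < ε) (hε_one : ε < 1) (h g : ℕ)
    (hh : ⌈3 + 2 ^ nonlinearDepth P q *
        (Real.logb 2 (1 / ε) + (sccDepth P : ℝ) *
          (Real.logb 2 (alphaConst P q ^ (-(4 * (n : ℤ) + 1))) + Real.logb 2 (16 * (n : ℝ)) +
            Real.logb 2 ‖fun i => MvPolynomial.eval 1 (P i)‖))⌉ ≤ (h : ℤ))
    (hg : h ≤ g + 1) :
    (∃! r : Fin n → ℝ, RDNMReturns P q h g r) ∧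
    ∀ r : Fin n → ℝ, RDNMReturns P q h g r → r ≤ q ∧ ‖q - r‖ ≤ ε := by
  have : Nonempty (Fin n) := ⟨⟨0, hn⟩⟩
  let i₀ : Fin n := ⟨0, hn⟩
  have hμ : 0 < coeffMin P :=
    coeffMin_pos hP (q := q) (i := i₀) ((hq_pos i₀).trans_eq (hq.1.2 i₀).symm)
  have ha0 : 0 < alphaConst P q := alphaConst_pos hμ hq_pos
  have haq := (two_mul_alphaConst_le (P := P) hμ hq_pos i₀).1
  have ha1 : alphaConst P q ≤ 1 := by linarith [hq_one i₀]
  set K := ‖fun i => MvPolynomial.eval 1 (P i)‖ with hKdef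
  have hK : ∀ i, eval 1 (P i) ≤ K := fun i =>
    (le_abs_self _).trans (norm_le_pi_norm (fun i => MvPolynomial.eval 1 (P i)) i)
  have hKa : 2 * alphaConst P q ≤ K := by
    obtain ⟨R, hR⟩ := exists_represents hP hquad fun i m => coeffMin_le hP
    have h1 := R.map_mono hq.1.1 hq_one i₀
    rw [← hR.eval_eq, hq.1.2] at h1
    have h2 := hK i₀
    rw [hR.eval_eq] at h2
    exact haq.trans (h1.trans h2)
  have hK0 : 0 < K := by linarith
  have hn1 : (1 : ℝ) ≤ n := by exact_mod_cast hn
  have hθ := eight_mul_inv_two_pow_le ha0 hn hK0 hε_pos hh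
  set Λ := alphaConst P q ^ (-(4 * (n : ℤ) + 1)) * (16 * n) * K with hΛdef
  have hΛ : Λ * alphaConst P q ^ (4 * n + 1) = 16 * n * K := by
    rw [hΛdef, zpow_neg, show (4 * (n : ℤ) + 1) = ((4 * n + 1 : ℕ) : ℤ) by push_cast; rfl,
      zpow_natCast]
    field_simp
  have hΛa : 1 ≤ Λ * alphaConst P q ^ (4 * n) := by
    have h1 : alphaConst P q * 1 ≤ alphaConst P q * (Λ * alphaConst P q ^ (4 * n)) := by
      calc alphaConst P q * 1 ≤ 16 * 1 * K := by linarith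
        _ ≤ 16 * n * K := by gcongr
        _ = _ := by rw [← hΛ]; ring
    exact le_of_mul_le_mul_left h1 ha0
  have hΛ0 : 0 < Λ := by positivity
  have hΛ1 : 1 ≤ Λ := hΛa.trans (mul_le_of_le_one_right hΛ0.le (pow_le_one₀ ha0.le ha1))
  have hθ0 : 0 < ε / Λ ^ sccDepth P := by positivity
  have hθ1 : ε / Λ ^ sccDepth P ≤ 1 :=
    (div_le_one (by positivity)).2 (hε_one.le.trans (one_le_pow₀ hΛ1))
  have main : ∀ r : Fin n → ℝ, (∀ i, r i = rdnmStep P q h g r i) → _ := fun r hr =>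
    rdnm_error hP hquad hq hq_pos hq_one hK hK0.le ha0 ha1
      (by rw [Fintype.card_fin]; exact hΛ) hΛ1 (by rw [Fintype.card_fin]; exact hΛa) hθ0 hθ1 hθ hg hr
  obtain ⟨r, hr, huniq⟩ := existsUnique_rdnmStep_fixed P q h g
  refine ⟨⟨r, rdnmReturns_of_eq_rdnmStep hr fun i => (main r hr i).1,
    fun r' hr' => huniq r' hr'.eq_rdnmStep⟩, fun r' hr' => ?_⟩
  have hb := main r' hr'.eq_rdnmStep
  refine ⟨fun i => (hb i).2.2.1, (pi_norm_le_iff_of_nonneg hε_pos.le).2 fun i => ?_⟩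
  obtain ⟨-, -, hle, l, hl, herr⟩ := hb i
  rw [Pi.sub_apply, Real.norm_eq_abs, abs_of_nonneg (sub_nonneg.2 hle)]
  have hlen : l.length + 1 ≤ sccDepth P := hl.length_le_sccDepth
  calc q i - r' i ≤ Λ ^ (l.length + 1) * (ε / Λ ^ sccDepth P) ^ 2 ^ _ := herr
    _ ≤ Λ ^ sccDepth P * (ε / Λ ^ sccDepth P) := by
      gcongr ?_ * ?_
      · exact pow_le_pow_right₀ hΛ1 hlen
      · exact pow_le_of_le_one hθ0.le hθ1 (pow_pos two_pos _).ne'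
    _ = ε := mul_div_cancel₀ _ (by positivity)
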